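/- Write $[n]=\{1,\dots,n\}$, $\Sigma(n,2)=\binom{n}{\lfloor n/2\rfloor}+\binom{n}{\lfloor n/2\rfloor+1}$ and $f(n)=\left(\lceil n/2\rceil+1\right)\binom{\lceil n/2\rceil}{2}$. For a family $\mathcal F\subseteq 2^{[n]}$, a butterfly contained in $\mathcal F$ is a subfamily of four distinct members of $\mathcal F$ that can be labelled $A,B,C,D$ so that each of $A,B$ is a subset of each of $C,D$ (further inclusions are allowed); let $b(\mathcal F)$ be the number of such subfamilies. (a) Let $E:\mathbb N\to\mathbb N$ satisfy $\log E(n)=o(n)$ as $n\to\infty$ (with the convention $\log 0=0$). Then there is a sequence $\delta_n\to 0$, depending only on the function $E$, such that for every $n$ and every $\mathcal F\subseteq 2^{[n]}$ with $|\mathcal F|=\Sigma(n,2)+E(n)$ we have $b(\mathcal F)\ge(1-\delta_n)\,E(n)\,f(n)$. (b) Let $n,E\ge 0$ be integers with $E\le n/100$. Then every $\mathcal F\subseteq 2^{[n]}$ with $|\mathcal F|=\Sigma(n,2)+E$ satisfies $b(\mathcal F)\ge E\,f(n)$, and this bound is exact: there is such a family $\mathcal F$ with $b(\mathcal F)=E\,f(n)$.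 -/

import Mathlib

open Filter Asymptotics

namespace Butterflies

/-- The four elements of the butterfly poset. -/
inductive Butterfly : Type
  | a | b | c | d

/-- The order relation of the butterfly: apart from reflexivity, the relations are exactly
`a ≤ c`, `a ≤ d`, `b ≤ c`, `b ≤ d`. -/
inductive Butterfly.Le : Butterfly → Butterfly → Prop
  | refl (x : Butterfly) : Butterfly.Le x x
  | ac : Butterfly.Le .a .c
  | ad : Butterfly.Le .a .d
  | bc : Butterfly.Le .b .c
  | bd : Butterfly.Le .b .d

instance : PartialOrder Butterfly where
  le := Butterfly.Le
  le_refl := Butterfly.Le.refl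
  le_trans := by
    intro x y z hxy hyz
    cases hxy <;> cases hyz <;> constructor
  le_antisymm := by
    intro x y hxy hyx
    cases hxy <;> cases hyx <;> rfl

/-- `S` is a copy of the poset `P`: it is the image of an injection `i` from `P` into the sets
such that `p ≤ q` implies `i p ⊆ i q` (the converse implication is not required). -/
def IsCopy (P : Type) [PartialOrder P] {n : ℕ} (S : Finset (Finset (Fin n))) : Prop :=
  ∃ i : P → Finset (Fin n),
    Function.Injective i ∧ (∀ p q : P, p ≤ q → i p ⊆ i q) ∧ Set.range i = (S : Set (Finset (Fin n)))

/-- The number of butterflies contained in `F`: copies are counted as image sets. -/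
noncomputable def butterflyCount {n : ℕ} (F : Finset (Finset (Fin n))) : ℕ :=
  {S : Finset (Finset (Fin n)) | S ⊆ F ∧ IsCopy Butterfly S}.ncard

/-- `Σ(n,2)`, the sum of the two largest binomial coefficients of order `n`
(`n / 2` is rounded down). -/
def sigmaTwo (n : ℕ) : ℕ := n.choose (n / 2) + n.choose (n / 2 + 1)

/-- `f(n) = (⌈n/2⌉ + 1) * C(⌈n/2⌉, 2)`; the natural number `(n + 1) / 2` is `⌈n/2⌉`. -/
def f (n : ℕ) : ℕ := ((n + 1) / 2 + 1) * ((n + 1) / 2).choose 2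

end Butterflies

namespace Butterflies

/-! Write m = ⌈n/2⌉. If `F` contains two full consecutive middle levels k and k+1, then every
further member G lies in at least f(n) butterflies having G as their only member off these levels:
for G below them, take B in level k above G (at least m+1 choices) and two covers of B (at least
C(m,2) choices); dually for G above. The lower bounds amount to showing that a family with fewer
than E f(n) butterflies is close enough to such a configuration.

Deleting one set per butterfly leaves a butterfly-free family of size at least Σ(n,2) - E f(n), up
to two sets. A LYM inequality, in which the chain weights of a butterfly-free family sum to at most
2, yields stability (`ButterflyFree.stability`): only a polynomial multiple of E f(n) sets are
missing from some pair of middle levels. For odd n this follows from the weights alone. For even n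
the levels n/2 - 1 and n/2 + 1 have equal weight; a family mixing them would split the central level
into two large parts with a small separator in the Johnson graph, which
`card_mul_card_le_of_separated` forbids.

If r sets are missing, then r+E members lie off the two levels. To limit the damage done by the
missing sets R, let R percolate in the cube at threshold h. By edge isoperimetry the closure Z gains
few sets (`exists_percolation_closure`), while a set outside Z has fewer than h neighbours in Z and
so still lies in nearly f(n) butterflies when h is small against m. Counting over the members off
the levels and outside Z gives the asymptotic bound in (a).

For (b) the same count is run twice, bringing r down first to O(n) and then below n/5. At that size
each missing set spoils at most two choices of B, and (r+E)(m+1-2r) ≥ E(m+1) gives the exact bound.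
It is attained by two middle levels and E well-separated sets just below them. -/

theorem mul_log_add_mul_log_le {a b : ℝ} (ha : 0 < a) (hab : a ≤ b) :
    a * Real.log a + b * Real.log b + 2 * a * Real.log 2 ≤ (a + b) * Real.log (a + b) := by
  have hb : 0 < b := ha.trans_le hab
  have h1 : Real.log 2 ≤ Real.log (a + b) - Real.log a := by
    rw [← Real.log_div (by positivity) ha.ne']
    apply Real.log_le_log (by norm_num)
    rw [le_div_iff₀ ha]; linarith
  -- Bernoulli with exponent b/a ≥ 1: 2 ≤ (1 + a/b)^(b/a). Together with `h1` this produces the term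
  -- 2a log 2, which pays for the cross edges in the isoperimetric induction.
  have h2 : a * Real.log 2 ≤ b * (Real.log (a + b) - Real.log b) := by
    rw [← Real.log_div (by positivity) hb.ne']
    have h3 : (1 : ℝ) + b / a * (a / b) ≤ (1 + a / b) ^ (b / a) :=
      one_add_mul_self_le_rpow_one_add (by linarith [div_pos ha hb]) ((one_le_div ha).2 hab)
    have h4 : b / a * (a / b) = 1 := by field_simp
    rw [h4] at h3
    have h5 := Real.log_le_log (by norm_num) h3
    rw [Real.log_rpow (by positivity)] at h5
    have h6 : (a + b) / b = 1 + a / b := by field_simp; ring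
    rw [h6]
    have h7 : a * Real.log (1 + 1) ≤ a * (b / a * Real.log (1 + a / b)) :=
      mul_le_mul_of_nonneg_left h5 ha.le
    have h8 : a * (b / a * Real.log (1 + a / b)) = b * Real.log (1 + a / b) := by field_simp
    rw [h8] at h7
    norm_num at h7 ⊢
    exact h7
  nlinarith [mul_le_mul_of_nonneg_left h1 ha.le]

/-! ### Edge isoperimetry and bootstrap percolation in the Hamming cube. -/

section Cube

variable {α : Type*} [DecidableEq α] [Fintype α]

/-- The number of neighbours of `v` in the Hamming cube that lie in `S`. -/
def cubeDegree (S : Finset (Finset α)) (v : Finset α) : ℕ :=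
  (Finset.univ.filter fun x : α => symmDiff v {x} ∈ S).card

theorem mem_symmDiff_singleton {v : Finset α} {x y : α} :
    y ∈ symmDiff v {x} ↔ (y ∈ v ∧ y ≠ x) ∨ (y = x ∧ y ∉ v) := by
  simp [Finset.mem_symmDiff]

theorem symmDiff_singleton_inj {v : Finset α} {x y : α} (h : symmDiff v {x} = symmDiff v {y}) :
    x = y := by
  simpa using symmDiff_right_injective v h

theorem cubeDegree_mono {S T : Finset (Finset α)} (h : S ⊆ T) (v : Finset α) :
    cubeDegree S v ≤ cubeDegree T v :=
  Finset.card_le_card fun x hx => by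
    simp only [Finset.mem_filter, Finset.mem_univ, true_and] at hx ⊢
    exact h hx

/-- Splitting `S` by membership of `x`: the cost is at most twice the size of either part. -/
theorem sum_cubeDegree_union_le {S T : Finset (Finset α)} {x : α} (hS : ∀ v ∈ S, x ∈ v)
    (hT : ∀ v ∈ T, x ∉ v) :
    ∑ v ∈ S ∪ T, cubeDegree (S ∪ T) v
      ≤ ∑ v ∈ S, cubeDegree S v + ∑ v ∈ T, cubeDegree T v + 2 * S.card := by
  have hdis : Disjoint S T := Finset.disjoint_left.2 fun v h1 h2 => hT v h2 (hS v h1)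
  rw [Finset.sum_union hdis]
  have h1 : ∀ v ∈ S, cubeDegree (S ∪ T) v ≤ cubeDegree S v + 1 := by
    intro v hv
    have : (Finset.univ.filter fun y : α => symmDiff v {y} ∈ S ∪ T) ⊆
        insert x (Finset.univ.filter fun y : α => symmDiff v {y} ∈ S) := by
      intro y hy
      simp only [Finset.mem_filter, Finset.mem_univ, true_and, Finset.mem_union,
        Finset.mem_insert] at hy ⊢
      rcases hy with hy | hy
      · exact Or.inr hy
      · left
        by_contra hne
        exact hT _ hy (mem_symmDiff_singleton.2 (Or.inl ⟨hS v hv, fun h => hne h.symm⟩))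
    exact (Finset.card_le_card this).trans (Finset.card_insert_le _ _)
  have h2 : ∀ v ∈ T, cubeDegree (S ∪ T) v
      ≤ cubeDegree T v + if symmDiff v {x} ∈ S then 1 else 0 := by
    intro v hv
    by_cases hx : symmDiff v {x} ∈ S
    · have : (Finset.univ.filter fun y : α => symmDiff v {y} ∈ S ∪ T) ⊆
        insert x (Finset.univ.filter fun y : α => symmDiff v {y} ∈ T) := by
        intro y hy
        simp only [Finset.mem_filter, Finset.mem_univ, true_and, Finset.mem_union,
          Finset.mem_insert] at hy ⊢
        rcases hy with hy | hy
        · left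
          have := hS _ hy
          rw [mem_symmDiff_singleton] at this
          rcases this with h | h
          · exact absurd h.1 (hT v hv)
          · exact h.1.symm
        · exact Or.inr hy
      rw [if_pos hx]
      exact (Finset.card_le_card this).trans (Finset.card_insert_le _ _)
    · rw [if_neg hx, add_zero]
      refine Finset.card_le_card fun y hy => ?_
      simp only [Finset.mem_filter, Finset.mem_univ, true_and, Finset.mem_union] at hy ⊢
      rcases hy with hy | hy
      · have := hS _ hy
        rw [mem_symmDiff_singleton] at this
        rcases this with h | h
        · exact absurd h.1 (hT v hv)
        · rw [← h.1] at hy; exact absurd hy hx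
      · exact hy
  -- All cross edges have direction `x`, so they form a matching with at most |S| edges; each is
  -- counted from both ends, whence 2|S|.
  have h3 : ∑ v ∈ T, (if symmDiff v {x} ∈ S then 1 else 0) ≤ S.card := by
    rw [← Finset.sum_filter, ← Finset.card_eq_sum_ones]
    refine Finset.card_le_card_of_injOn (fun v => symmDiff v {x}) ?_ ?_
    · intro v hv
      simp only [Finset.coe_filter, Set.mem_ofPred_eq] at hv
      exact hv.2
    · intro v _ w _ h
      exact symmDiff_left_injective _ h
  calc _ ≤ ∑ v ∈ S, (cubeDegree S v + 1)
        + ∑ v ∈ T, (cubeDegree T v + if symmDiff v {x} ∈ S then 1 else 0) :=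
        add_le_add (Finset.sum_le_sum h1) (Finset.sum_le_sum h2)
    _ ≤ _ := by
        rw [Finset.sum_add_distrib, Finset.sum_add_distrib]
        simp only [Finset.sum_const, smul_eq_mul, mul_one]
        omega

/-- The edge-isoperimetric inequality in the Hamming cube. -/
theorem sum_cubeDegree_mul_log_two_le (S : Finset (Finset α)) :
    ((∑ v ∈ S, cubeDegree S v : ℕ) : ℝ) * Real.log 2 ≤ S.card * Real.log S.card := by
  induction hn : S.card using Nat.strong_induction_on generalizing S with
  | _ n ih =>
  by_cases h1 : S.card ≤ 1
  · have : ∑ v ∈ S, cubeDegree S v = 0 := by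
      refine Finset.sum_eq_zero fun v hv => ?_
      rw [cubeDegree, Finset.card_eq_zero, Finset.filter_eq_empty_iff]
      intro x _ hx
      have := Finset.card_le_one.1 h1 _ hx _ hv
      have h2 : x ∈ symmDiff v {x} ↔ x ∈ v := by rw [this]
      rw [mem_symmDiff_singleton] at h2
      tauto
    rw [this]
    simp only [Nat.cast_zero, zero_mul]
    positivity
  · push Not at h1
    obtain ⟨A, hA, B, hB, hAB⟩ := Finset.one_lt_card.1 h1
    obtain ⟨x, hx⟩ : ∃ x, ¬ (x ∈ A ↔ x ∈ B) := by
      by_contra hcon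
      push Not at hcon
      exact hAB (Finset.ext hcon)
    set S1 := S.filter (fun v => x ∈ v) with hS1
    set S0 := S.filter (fun v => x ∉ v) with hS0
    have hU : S1 ∪ S0 = S := Finset.filter_union_filter_not_eq _ _
    have hc : S1.card + S0.card = S.card := Finset.card_filter_add_card_filter_not _
    have hp1 : 0 < S1.card := Finset.card_pos.2 (by
      by_cases hxA : x ∈ A
      · exact ⟨A, Finset.mem_filter.2 ⟨hA, hxA⟩⟩
      · exact ⟨B, Finset.mem_filter.2 ⟨hB, by tauto⟩⟩)
    have hp0 : 0 < S0.card := Finset.card_pos.2 (by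
      by_cases hxA : x ∈ A
      · exact ⟨B, Finset.mem_filter.2 ⟨hB, by tauto⟩⟩
      · exact ⟨A, Finset.mem_filter.2 ⟨hA, hxA⟩⟩)
    have hm1 : ∀ v ∈ S1, x ∈ v := fun v hv => (Finset.mem_filter.1 hv).2
    have hm0 : ∀ v ∈ S0, x ∉ v := fun v hv => (Finset.mem_filter.1 hv).2
    have i1 := ih _ (by omega) S1 rfl
    have i0 := ih _ (by omega) S0 rfl
    -- The splitting bound charges the part containing `x`. If that part is the larger one, the
    -- reflection in `x` exchanges the roles of the parts and preserves degrees.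
    have key : ∑ v ∈ S, cubeDegree S v ≤ ∑ v ∈ S1, cubeDegree S1 v + ∑ v ∈ S0, cubeDegree S0 v
        + 2 * min S1.card S0.card := by
      rcases le_total S1.card S0.card with h | h
      · have := sum_cubeDegree_union_le hm1 hm0
        rw [hU] at this
        rw [min_eq_left h]; exact this
      · -- reflect in the coordinate `x`
        have hinj : Function.Injective (fun v : Finset α => symmDiff v {x}) :=
          symmDiff_left_injective _
        have hdeg : ∀ (T : Finset (Finset α)) (v : Finset α),
            cubeDegree (T.image fun v => symmDiff v {x}) (symmDiff v {x}) = cubeDegree T v := by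
          intro T v
          unfold cubeDegree
          congr 1
          ext y
          simp only [Finset.mem_filter, Finset.mem_univ, true_and]
          rw [symmDiff_right_comm, Finset.mem_image]
          constructor
          · rintro ⟨w, hw, h⟩
            rwa [← hinj h]
          · intro hw
            exact ⟨_, hw, rfl⟩
        have hsum : ∀ T : Finset (Finset α),
            ∑ v ∈ T.image (fun v => symmDiff v {x}),
              cubeDegree (T.image fun v => symmDiff v {x}) v = ∑ v ∈ T, cubeDegree T v := by
          intro T
          rw [Finset.sum_image (fun a _ b _ h => hinj h)]
          exact Finset.sum_congr rfl fun v _ => hdeg T v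
        have := sum_cubeDegree_union_le (S := S0.image fun v => symmDiff v {x})
          (T := S1.image fun v => symmDiff v {x}) (x := x)
          (by
            intro v hv
            obtain ⟨w, hw, rfl⟩ := Finset.mem_image.1 hv
            exact mem_symmDiff_singleton.2 (Or.inr ⟨rfl, hm0 w hw⟩))
          (by
            intro v hv
            obtain ⟨w, hw, rfl⟩ := Finset.mem_image.1 hv
            have := hm1 w hw
            rw [mem_symmDiff_singleton]
            tauto)
        rw [← Finset.image_union, hsum, hsum, hsum, Finset.card_image_of_injective _ hinj,
          Finset.union_comm, hU] at this
        rw [min_eq_right h]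
        omega
    have hl2 : 0 < Real.log 2 := Real.log_pos (by norm_num)
    have key' : ((∑ v ∈ S, cubeDegree S v : ℕ) : ℝ) ≤ ((∑ v ∈ S1, cubeDegree S1 v : ℕ) : ℝ)
        + ((∑ v ∈ S0, cubeDegree S0 v : ℕ) : ℝ) + 2 * min (S1.card : ℝ) (S0.card : ℝ) := by
      have := (Nat.cast_le (α := ℝ)).2 key
      rw [Nat.cast_add, Nat.cast_add, Nat.cast_mul, Nat.cast_min] at this
      exact_mod_cast this
    have hf : (S1.card : ℝ) * Real.log S1.card + S0.card * Real.log S0.card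
        + 2 * min (S1.card : ℝ) (S0.card : ℝ) * Real.log 2 ≤ S.card * Real.log S.card := by
      rw [← hc, Nat.cast_add]
      rcases le_total (S1.card : ℝ) (S0.card : ℝ) with h | h
      · rw [min_eq_left h]
        exact mul_log_add_mul_log_le (by exact_mod_cast hp1) h
      · rw [min_eq_right h, add_comm (S1.card : ℝ) (S0.card : ℝ)]
        have := mul_log_add_mul_log_le (a := S0.card) (by exact_mod_cast hp0) h
        linarith
    rw [← hn]
    have := mul_le_mul_of_nonneg_right key' hl2.le
    nlinarith

/-- Adding to `Z` a vertex `v ∉ Z` increases twice the number of edges by twice the degree. -/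
theorem sum_cubeDegree_insert {Z : Finset (Finset α)} {v : Finset α} (hv : v ∉ Z) :
    ∑ w ∈ Z, cubeDegree Z w + 2 * cubeDegree Z v
      ≤ ∑ w ∈ insert v Z, cubeDegree (insert v Z) w := by
  rw [Finset.sum_insert hv]
  have h1 : cubeDegree Z v ≤ cubeDegree (insert v Z) v :=
    cubeDegree_mono (Finset.subset_insert _ _) v
  have h2 : ∑ w ∈ Z, cubeDegree Z w + cubeDegree Z v ≤ ∑ w ∈ Z, cubeDegree (insert v Z) w := by
    have h3 : cubeDegree Z v ≤ ∑ w ∈ Z, if ∃ x, symmDiff v {x} = w then 1 else 0 := by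
      rw [← Finset.sum_filter, ← Finset.card_eq_sum_ones]
      refine Finset.card_le_card_of_injOn (fun x => symmDiff v {x}) ?_ ?_
      · intro x hx
        simp only [Finset.coe_filter, Finset.mem_univ, true_and, Set.mem_ofPred_eq] at hx ⊢
        exact ⟨hx, x, rfl⟩
      · intro x _ y _ h
        exact symmDiff_singleton_inj h
    refine (Nat.add_le_add_left h3 _).trans ?_
    rw [← Finset.sum_add_distrib]
    refine Finset.sum_le_sum fun w hw => ?_
    split_ifs with hx
    · obtain ⟨x, rfl⟩ := hx
      have hvx : symmDiff (symmDiff v {x}) {x} = v := by simp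
      have hsub : insert x (Finset.univ.filter fun y : α => symmDiff (symmDiff v {x}) {y} ∈ Z) ⊆
          (Finset.univ.filter fun y : α => symmDiff (symmDiff v {x}) {y} ∈ insert v Z) := by
        intro y hy
        simp only [Finset.mem_filter, Finset.mem_univ, true_and, Finset.mem_insert] at hy ⊢
        rcases hy with rfl | hy
        · exact Or.inl hvx
        · exact Or.inr hy
      have := Finset.card_le_card hsub
      rwa [Finset.card_insert_of_notMem (by simp [hv])] at this
    · exact cubeDegree_mono (Finset.subset_insert _ _) w
  omega

/-- Bootstrap percolation with a large threshold `h` in the Hamming cube, started from a small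
set `R`, stops early. -/
theorem exists_percolation_closure (R : Finset (Finset α)) {h l : ℕ} (hl : l < h)
    (hR : 2 * R.card ≤ 2 ^ l) :
    ∃ Z : Finset (Finset α), R ⊆ Z ∧ (∀ v ∉ Z, cubeDegree Z v < h) ∧
      2 * h * (Z \ R).card ≤ l * (R.card + (Z \ R).card) := by
  have hl2 : 0 < Real.log 2 := Real.log_pos (by norm_num)
  have bound : ∀ Z : Finset (Finset α), R ⊆ Z → (Z \ R).card ≤ R.card →
      2 * h * (Z \ R).card ≤ ∑ w ∈ Z, cubeDegree Z w →
      2 * h * (Z \ R).card ≤ l * (R.card + (Z \ R).card) := by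
    intro Z hRZ hc he
    have hZ : Z.card = R.card + (Z \ R).card := by
      rw [Finset.card_sdiff_of_subset hRZ]
      have := Finset.card_le_card hRZ
      omega
    have h1 := sum_cubeDegree_mul_log_two_le Z
    have h2 : (Z.card : ℝ) * Real.log Z.card ≤ Z.card * (l * Real.log 2) := by
      rcases Nat.eq_zero_or_pos Z.card with h0 | h0
      · simp [h0]
      · refine mul_le_mul_of_nonneg_left ?_ (by positivity)
        rw [← Real.log_pow]
        refine Real.log_le_log (by exact_mod_cast h0) ?_
        have : Z.card ≤ 2 ^ l := by omega
        exact_mod_cast this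
    have h3 : ((∑ w ∈ Z, cubeDegree Z w : ℕ) : ℝ) ≤ Z.card * l := by
      have : ((∑ v ∈ Z, cubeDegree Z v : ℕ) : ℝ) * Real.log 2 ≤ (Z.card * l) * Real.log 2 := by
        linarith
      exact le_of_mul_le_mul_right this hl2
    have h4 : ∑ w ∈ Z, cubeDegree Z w ≤ Z.card * l := by exact_mod_cast h3
    rw [← hZ, mul_comm l]
    omega
  -- A largest member of `P` replaces running the percolation. Each added set contributes at least
  -- `h` edges, hence 2h to the degree sum, whereas isoperimetry allows at most l|Z| as long as |Z|
  -- ≤ 2|R| ≤ 2^l.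
  let P := (Finset.univ : Finset (Finset (Finset α))).filter fun Z =>
    R ⊆ Z ∧ (Z \ R).card ≤ R.card ∧ 2 * h * (Z \ R).card ≤ ∑ w ∈ Z, cubeDegree Z w
  have hP : P.Nonempty := ⟨R, by simp [P]⟩
  obtain ⟨Z, hZP, hmax⟩ := Finset.exists_max_image P Finset.card hP
  obtain ⟨-, hRZ, hc, he⟩ := Finset.mem_filter.1 hZP
  refine ⟨Z, hRZ, ?_, bound Z hRZ hc he⟩
  intro v hv
  by_contra hdeg
  push Not at hdeg
  have hvR : v ∉ R := fun h' => hv (hRZ h')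
  have hb := bound Z hRZ hc he
  have hcard : ((insert v Z) \ R).card = (Z \ R).card + 1 := by
    rw [Finset.insert_sdiff_of_notMem _ hvR, Finset.card_insert_of_notMem]
    simp [hv]
  -- The cap |Z \ R| ≤ |R| never stops the process: equality with `R` nonempty would force h ≤ l.
  have hlt : (Z \ R).card < R.card := by
    by_contra hge
    have heq : (Z \ R).card = R.card := le_antisymm hc (not_lt.1 hge)
    rcases Nat.eq_zero_or_pos R.card with h0 | h0
    · have hZ0 : Z = ∅ := by
        have h1 : R = ∅ := Finset.card_eq_zero.1 h0
        have h2 : (Z \ R) = ∅ := Finset.card_eq_zero.1 (by omega)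
        rwa [h1, Finset.sdiff_empty] at h2
      rw [hZ0] at hdeg
      simp [cubeDegree] at hdeg
      omega
    · rw [heq] at hb
      nlinarith
  have hmem : insert v Z ∈ P := by
    refine Finset.mem_filter.2 ⟨Finset.mem_univ _, hRZ.trans (Finset.subset_insert _ _), ?_, ?_⟩
    · omega
    · have := sum_cubeDegree_insert hv
      rw [hcard]
      nlinarith
  have := hmax _ hmem
  rw [Finset.card_insert_of_notMem hv] at this
  omega

end Cube

/-! ### Butterflies as configurations of four sets, and butterfly-free families. -/

section Basic

variable {n : ℕ}

theorem isCopy_butterfly_iff {S : Finset (Finset (Fin n))} :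
    IsCopy Butterfly S ↔ ∃ A B C D : Finset (Fin n), A ≠ B ∧ C ≠ D ∧ A ⊂ C ∧ A ⊂ D ∧ B ⊂ C ∧ B ⊂ D ∧
      S = {A, B, C, D} := by
  constructor
  · rintro ⟨i, hi, hle, hr⟩
    have hss : ∀ p q : Butterfly, p ≤ q → p ≠ q → i p ⊂ i q := fun p q h hne =>
      (hle p q h).ssubset_of_ne fun h' => hne (hi h')
    refine ⟨i .a, i .b, i .c, i .d, fun h => ?_, fun h => ?_, hss _ _ .ac (by simp),
      hss _ _ .ad (by simp), hss _ _ .bc (by simp), hss _ _ .bd (by simp), ?_⟩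
    · simpa using hi h
    · simpa using hi h
    · ext X
      rw [← Finset.mem_coe, ← hr]
      simp only [Set.mem_range, Finset.mem_insert, Finset.mem_singleton]
      constructor
      · rintro ⟨p, rfl⟩
        cases p <;> simp
      · rintro (rfl | rfl | rfl | rfl) <;> exact ⟨_, rfl⟩
  · rintro ⟨A, B, C, D, hAB, hCD, hAC, hAD, hBC, hBD, rfl⟩
    refine ⟨fun p => match p with | .a => A | .b => B | .c => C | .d => D, ?_, ?_, ?_⟩
    · intro p q h
      cases p <;> cases q <;> first
        | rfl
        | exact absurd h hAB | exact absurd h.symm hAB | exact absurd h hCD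
        | exact absurd h.symm hCD | exact absurd h hAC.ne | exact absurd h hAD.ne
        | exact absurd h hBC.ne | exact absurd h hBD.ne | exact absurd h hAC.ne'
        | exact absurd h hAD.ne' | exact absurd h hBC.ne' | exact absurd h hBD.ne'
    · intro p q h
      cases h
      · exact subset_rfl
      · exact hAC.subset
      · exact hAD.subset
      · exact hBC.subset
      · exact hBD.subset
    · ext X
      simp only [Set.mem_range, Finset.coe_insert, Finset.coe_singleton, Set.mem_insert_iff,
        Set.mem_singleton_iff]
      constructor
      · rintro ⟨p, rfl⟩
        cases p <;> simp
      · rintro (rfl | rfl | rfl | rfl)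
        exacts [⟨.a, rfl⟩, ⟨.b, rfl⟩, ⟨.c, rfl⟩, ⟨.d, rfl⟩]

theorem IsCopy.card_eq {S : Finset (Finset (Fin n))} (h : IsCopy Butterfly S) : S.card = 4 := by
  obtain ⟨A, B, C, D, hAB, hCD, hAC, hAD, hBC, hBD, rfl⟩ := isCopy_butterfly_iff.1 h
  rw [Finset.card_insert_of_notMem, Finset.card_insert_of_notMem, Finset.card_insert_of_notMem,
    Finset.card_singleton]
  · simpa using hCD
  · simp [hBC.ne, hBD.ne]
  · simp [hAB, hAC.ne, hAD.ne]

open Classical in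
/-- The butterflies contained in `F`. -/
noncomputable def butterflies (F : Finset (Finset (Fin n))) : Finset (Finset (Finset (Fin n))) :=
  F.powerset.filter fun S => IsCopy Butterfly S

theorem mem_butterflies {F S : Finset (Finset (Fin n))} :
    S ∈ butterflies F ↔ S ⊆ F ∧ IsCopy Butterfly S := by
  simp [butterflies]

theorem butterflyCount_eq_card (F : Finset (Finset (Fin n))) :
    butterflyCount F = (butterflies F).card := by
  rw [butterflyCount, ← Set.ncard_coe_finset]
  congr 1
  ext S
  simp [mem_butterflies]

/-- A family is butterfly-free if it contains no butterfly. -/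
def ButterflyFree (F : Finset (Finset (Fin n))) : Prop :=
  ∀ A ∈ F, ∀ B ∈ F, ∀ C ∈ F, ∀ D ∈ F, A ≠ B → C ≠ D → A ⊂ C → A ⊂ D → B ⊂ C → B ⊂ D → False

/-- Delete one chosen member of each butterfly. -/
theorem exists_butterflyFree_subset (F : Finset (Finset (Fin n))) :
    ∃ G ⊆ F, ButterflyFree G ∧ F.card ≤ G.card + butterflyCount F := by
  classical
  have hne : ∀ S : Finset (Finset (Fin n)), S ∈ butterflies F → ∃ A, A ∈ S := by
    intro S hS
    have := (mem_butterflies.1 hS).2.card_eq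
    exact Finset.card_pos.1 (by omega)
  choose! g hg using hne
  refine ⟨F \ (butterflies F).image g, Finset.sdiff_subset, ?_, ?_⟩
  · intro A hA B hB C hC D hD hAB hCD hAC hAD hBC hBD
    have hS : {A, B, C, D} ∈ butterflies F := by
      refine mem_butterflies.2 ⟨?_, isCopy_butterfly_iff.2
        ⟨A, B, C, D, hAB, hCD, hAC, hAD, hBC, hBD, rfl⟩⟩
      intro X hX
      simp only [Finset.mem_insert, Finset.mem_singleton] at hX
      rcases hX with rfl | rfl | rfl | rfl
      exacts [(Finset.mem_sdiff.1 hA).1, (Finset.mem_sdiff.1 hB).1, (Finset.mem_sdiff.1 hC).1,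
        (Finset.mem_sdiff.1 hD).1]
    have hmem := hg _ hS
    have him : g {A, B, C, D} ∈ (butterflies F).image g := Finset.mem_image_of_mem _ hS
    generalize g {A, B, C, D} = X at hmem him
    simp only [Finset.mem_insert, Finset.mem_singleton] at hmem
    rcases hmem with rfl | rfl | rfl | rfl
    exacts [(Finset.mem_sdiff.1 hA).2 him, (Finset.mem_sdiff.1 hB).2 him,
      (Finset.mem_sdiff.1 hC).2 him, (Finset.mem_sdiff.1 hD).2 him]
  · rw [butterflyCount_eq_card]
    have h1 := Finset.le_card_sdiff ((butterflies F).image g) F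
    have h2 := Finset.card_image_le (s := butterflies F) (f := g)
    omega

end Basic

/-! ### Full chains, encoded as numberings, through one or two given sets. -/

section Chains

open Numbering

variable {X : Type*} [Fintype X] [DecidableEq X]

theorem IsPrefix.subset_or_subset {σ : Numbering X} {s t : Finset X} (hs : IsPrefix σ s)
    (ht : IsPrefix σ t) : s ⊆ t ∨ t ⊆ s :=
  (le_total s.card t.card).imp (hs.subset_of_card_le_card ht) (ht.subset_of_card_le_card hs)

/-- At most half of the full chains through `B` pass through a given nonempty `A ⊂ B`. -/
theorem two_mul_card_prefixed_inter_le {A B : Finset X} (hA : A.Nonempty) (hAB : A ⊂ B) :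
    2 * (prefixed A ∩ prefixed B).card ≤ (prefixed B).card := by
  have ha : 0 < A.card := hA.card_pos
  have hlt : A.card < B.card := Finset.card_lt_card hAB
  have hBX : B.card ≤ Fintype.card X := B.card_le_univ
  -- Swapping the last position inside `A` with the first one after it turns a chain through `A` and
  -- `B` into one through `B` that avoids `A`. Nonemptiness of `A` makes the first of these a
  -- position of `A`.
  let p : Fin (Fintype.card X) := ⟨A.card - 1, by omega⟩
  let q : Fin (Fintype.card X) := ⟨A.card, by omega⟩
  have hmem : ∀ σ ∈ prefixed A ∩ prefixed B,
      σ.trans (Equiv.swap p q) ∈ prefixed B \ (prefixed A ∩ prefixed B) := by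
    intro σ hσ
    simp only [Finset.mem_inter, mem_prefixed, Finset.mem_sdiff] at hσ ⊢
    obtain ⟨h1, h2⟩ := hσ
    refine ⟨fun x => ?_, fun hcon => ?_⟩
    · rw [h2 x, Equiv.trans_apply]
      by_cases hp : σ x = p
      · rw [hp, Equiv.swap_apply_left]; simp only [p, q]; omega
      · by_cases hq : σ x = q
        · rw [hq, Equiv.swap_apply_right]; simp only [p, q]; omega
        · rw [Equiv.swap_apply_of_ne_of_ne hp hq]
    · have h3 := hcon.1 (σ.symm p)
      have h4 := h1 (σ.symm p)
      simp only [Equiv.trans_apply, Equiv.apply_symm_apply, Equiv.swap_apply_left] at h3 h4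
      have h5 := h3.1 (h4.2 (by simp only [p]; omega))
      simp only [q] at h5
      omega
  have hle : (prefixed A ∩ prefixed B).card ≤ (prefixed B \ (prefixed A ∩ prefixed B)).card := by
    refine Finset.card_le_card_of_injOn (fun σ => σ.trans (Equiv.swap p q)) hmem ?_
    intro σ _ τ _ h
    ext x
    have h1 := congrArg (fun e : Numbering X => (Equiv.swap p q) (e x)) h
    exact congrArg Fin.val (by simpa using h1)
  rw [Finset.card_sdiff_of_subset Finset.inter_subset_right] at hle
  have := Finset.card_le_card (Finset.inter_subset_right (s₁ := prefixed A) (s₂ := prefixed B))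
  omega

/-- At most half of the full chains through `B` pass through a given `C ⊃ B`, `C ≠ univ`. -/
theorem two_mul_card_prefixed_inter_le' {B C : Finset X} (hC : C ≠ Finset.univ) (hBC : B ⊂ C) :
    2 * (prefixed B ∩ prefixed C).card ≤ (prefixed B).card := by
  have hlt : B.card < C.card := Finset.card_lt_card hBC
  have hCX : C.card < Fintype.card X := by
    rw [← Finset.card_univ]
    exact Finset.card_lt_card (Finset.ssubset_univ_iff.2 hC)
  -- The same swap at the end of `C`; position |C| exists because `C` is not the whole ground set.
  let p : Fin (Fintype.card X) := ⟨C.card - 1, by omega⟩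
  let q : Fin (Fintype.card X) := ⟨C.card, by omega⟩
  have hmem : ∀ σ ∈ prefixed B ∩ prefixed C,
      σ.trans (Equiv.swap p q) ∈ prefixed B \ (prefixed B ∩ prefixed C) := by
    intro σ hσ
    simp only [Finset.mem_inter, mem_prefixed, Finset.mem_sdiff] at hσ ⊢
    obtain ⟨h1, h2⟩ := hσ
    refine ⟨fun x => ?_, fun hcon => ?_⟩
    · rw [h1 x, Equiv.trans_apply]
      by_cases hp : σ x = p
      · rw [hp, Equiv.swap_apply_left]; simp only [p, q]; omega
      · by_cases hq : σ x = q
        · rw [hq, Equiv.swap_apply_right]; simp only [p, q]; omega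
        · rw [Equiv.swap_apply_of_ne_of_ne hp hq]
    · have h3 := hcon.2 (σ.symm p)
      have h4 := h2 (σ.symm p)
      simp only [Equiv.trans_apply, Equiv.apply_symm_apply, Equiv.swap_apply_left] at h3 h4
      have h5 := h3.1 (h4.2 (by simp only [p]; omega))
      simp only [q] at h5
      omega
  have hle : (prefixed B ∩ prefixed C).card ≤ (prefixed B \ (prefixed B ∩ prefixed C)).card := by
    refine Finset.card_le_card_of_injOn (fun σ => σ.trans (Equiv.swap p q)) hmem ?_
    intro σ _ τ _ h
    ext x
    have h1 := congrArg (fun e : Numbering X => (Equiv.swap p q) (e x)) h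
    exact congrArg Fin.val (by simpa using h1)
  rw [Finset.card_sdiff_of_subset Finset.inter_subset_left] at hle
  have := Finset.card_le_card (Finset.inter_subset_left (s₁ := prefixed B) (s₂ := prefixed C))
  omega

/-- On a chain with `c` members, all but the least member have a member below, and all but the
greatest have one above. -/
theorem card_mul_two_le_of_chain (T : Finset (Finset X))
    (hT : ∀ s ∈ T, ∀ t ∈ T, s ⊆ t ∨ t ⊆ s) :
    2 * T.card ≤ (T.filter fun B => ∃ A ∈ T, A ⊂ B).card
      + (T.filter fun B => ∃ C ∈ T, B ⊂ C).card + 2 := by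
  have h1 : (T.filter fun B => ¬ ∃ A ∈ T, A ⊂ B).card ≤ 1 := by
    refine Finset.card_le_one.2 fun s hs t ht => ?_
    simp only [Finset.mem_filter, not_exists, not_and] at hs ht
    by_contra hne
    rcases hT s hs.1 t ht.1 with h | h
    · exact ht.2 s hs.1 (h.ssubset_of_ne hne)
    · exact hs.2 t ht.1 (h.ssubset_of_ne (Ne.symm hne))
  have h2 : (T.filter fun B => ¬ ∃ C ∈ T, B ⊂ C).card ≤ 1 := by
    refine Finset.card_le_one.2 fun s hs t ht => ?_
    simp only [Finset.mem_filter, not_exists, not_and] at hs ht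
    by_contra hne
    rcases hT s hs.1 t ht.1 with h | h
    · exact hs.2 t ht.1 (h.ssubset_of_ne hne)
    · exact ht.2 s hs.1 (h.ssubset_of_ne (Ne.symm hne))
  have h3 := Finset.card_filter_add_card_filter_not (s := T) (fun B => ∃ A ∈ T, A ⊂ B)
  have h4 := Finset.card_filter_add_card_filter_not (s := T) (fun B => ∃ C ∈ T, B ⊂ C)
  omega

end Chains

/-! ### The LYM-type inequality for butterfly-free families. -/

section LYM

open Numbering

variable {n : ℕ}

/-- If `B` has members of `F` both below and above it, both are unique: two members below, `B` and a
member above would form a butterfly, and dually. Each of them lies on at most half of the chains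
through `B`. Otherwise one of the two counts is zero. The sets ∅ and `univ` must be excluded because
they lie on every chain. -/
theorem ButterflyFree.card_low_add_card_high_le {F : Finset (Finset (Fin n))}
    (hF : ButterflyFree F) (h0 : ∅ ∉ F) (h1 : Finset.univ ∉ F) {B : Finset (Fin n)} (hB : B ∈ F) :
    ((prefixed B).filter fun σ => ∃ A ∈ F, IsPrefix σ A ∧ A ⊂ B).card
      + ((prefixed B).filter fun σ => ∃ C ∈ F, IsPrefix σ C ∧ B ⊂ C).card
      ≤ (prefixed B).card := by
  by_cases hlow : ∃ A ∈ F, A ⊂ B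
  · by_cases hhigh : ∃ C ∈ F, B ⊂ C
    · obtain ⟨A, hA, hAB⟩ := hlow
      obtain ⟨C, hC, hBC⟩ := hhigh
      have hAu : ∀ A' ∈ F, A' ⊂ B → A' = A := by
        intro A' hA' hA'B
        by_contra hne
        exact hF A' hA' A hA B hB C hC hne hBC.ne hA'B (hA'B.trans hBC) hAB (hAB.trans hBC)
      have hCu : ∀ C' ∈ F, B ⊂ C' → C' = C := by
        intro C' hC' hBC'
        by_contra hne
        exact hF A hA B hB C' hC' C hC hAB.ne hne (hAB.trans hBC') (hAB.trans hBC) hBC' hBC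
      have e1 : ((prefixed B).filter fun σ => ∃ A ∈ F, IsPrefix σ A ∧ A ⊂ B) ⊆
          prefixed A ∩ prefixed B := by
        intro σ hσ
        obtain ⟨hσB, A', hA', hp, hlt⟩ := Finset.mem_filter.1 hσ
        rw [hAu A' hA' hlt] at hp
        exact Finset.mem_inter.2 ⟨mem_prefixed.2 hp, hσB⟩
      have e2 : ((prefixed B).filter fun σ => ∃ C ∈ F, IsPrefix σ C ∧ B ⊂ C) ⊆
          prefixed B ∩ prefixed C := by
        intro σ hσ
        obtain ⟨hσB, C', hC', hp, hlt⟩ := Finset.mem_filter.1 hσ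
        rw [hCu C' hC' hlt] at hp
        exact Finset.mem_inter.2 ⟨hσB, mem_prefixed.2 hp⟩
      have hAne : A.Nonempty := Finset.nonempty_iff_ne_empty.2 fun h => h0 (h ▸ hA)
      have hCne : C ≠ Finset.univ := fun h => h1 (h ▸ hC)
      have i1 := two_mul_card_prefixed_inter_le hAne hAB
      have i2 := two_mul_card_prefixed_inter_le' hCne hBC
      have := Finset.card_le_card e1
      have := Finset.card_le_card e2
      omega
    · have : ((prefixed B).filter fun σ => ∃ C ∈ F, IsPrefix σ C ∧ B ⊂ C) = ∅ := by
        refine Finset.filter_eq_empty_iff.2 fun σ _ hcon => hhigh ?_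
        obtain ⟨C, hC, -, h⟩ := hcon
        exact ⟨C, hC, h⟩
      rw [this, Finset.card_empty, add_zero]
      exact Finset.card_filter_le _ _
  · have : ((prefixed B).filter fun σ => ∃ A ∈ F, IsPrefix σ A ∧ A ⊂ B) = ∅ := by
      refine Finset.filter_eq_empty_iff.2 fun σ _ hcon => hlow ?_
      obtain ⟨A, hA, -, h⟩ := hcon
      exact ⟨A, hA, h⟩
    rw [this, Finset.card_empty, zero_add]
    exact Finset.card_filter_le _ _

/-- Let N be the number of incidences between chains and members of `F`. Chain by chain, 2N exceeds
the number of incidences with a member below plus those with a member above by at most 2 n!. Member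
by member, the latter two together are at most N. Hence 2N ≤ N + 2 n!. -/
theorem ButterflyFree.sum_card_prefixed_le {F : Finset (Finset (Fin n))}
    (hF : ButterflyFree F) (h0 : ∅ ∉ F) (h1 : Finset.univ ∉ F) :
    ∑ B ∈ F, (prefixed B).card ≤ 2 * n.factorial := by
  have hswap : ∀ P : Numbering (Fin n) → Finset (Fin n) → Prop, [∀ σ B, Decidable (P σ B)] →
      ∑ B ∈ F, ((prefixed B).filter fun σ => P σ B).card
        = ∑ σ : Numbering (Fin n), ((F.filter fun B => IsPrefix σ B).filter fun B => P σ B).card := by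
    intro P _
    simp only [prefixed, Finset.card_filter, Finset.filter_filter]
    rw [Finset.sum_comm]
  have h2 : ∑ B ∈ F, (prefixed B).card
      = ∑ σ : Numbering (Fin n), (F.filter fun B => IsPrefix σ B).card := by
    have := hswap (fun _ _ => True)
    simpa using this
  have hchain : ∀ σ : Numbering (Fin n), 2 * (F.filter fun B => IsPrefix σ B).card
      ≤ ((F.filter fun B => IsPrefix σ B).filter fun B => ∃ A ∈ F, IsPrefix σ A ∧ A ⊂ B).card
      + ((F.filter fun B => IsPrefix σ B).filter fun B => ∃ C ∈ F, IsPrefix σ C ∧ B ⊂ C).card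
      + 2 := by
    intro σ
    have := card_mul_two_le_of_chain (F.filter fun B => IsPrefix σ B) (by
      intro s hs t ht
      exact IsPrefix.subset_or_subset (Finset.mem_filter.1 hs).2 (Finset.mem_filter.1 ht).2)
    simpa only [Finset.mem_filter, and_assoc] using this
  have hsum := Finset.sum_le_sum fun σ (_ : σ ∈ Finset.univ) => hchain σ
  rw [← Finset.mul_sum, Finset.sum_add_distrib, Finset.sum_add_distrib, ← h2,
    ← hswap (fun σ B => ∃ A ∈ F, IsPrefix σ A ∧ A ⊂ B),
    ← hswap (fun σ B => ∃ C ∈ F, IsPrefix σ C ∧ B ⊂ C), ← Finset.sum_add_distrib] at hsum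
  have h3 := Finset.sum_le_sum fun B hB => hF.card_low_add_card_high_le h0 h1 (B := B) hB
  have h4 : ∑ _σ : Numbering (Fin n), 2 = 2 * n.factorial := by
    rw [Finset.sum_const, Finset.card_univ, Fintype.card_numbering, Fintype.card_fin, smul_eq_mul,
      mul_comm]
  omega

/-- The LYM-type inequality for butterfly-free families. -/
theorem ButterflyFree.sum_inv_choose_le {F : Finset (Finset (Fin n))}
    (hF : ButterflyFree F) (h0 : ∅ ∉ F) (h1 : Finset.univ ∉ F) :
    ∑ B ∈ F, ((n.choose B.card : ℝ))⁻¹ ≤ 2 := by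
  have h := hF.sum_card_prefixed_le h0 h1
  have hn : (0 : ℝ) < n.factorial := by exact_mod_cast n.factorial_pos
  have h2 : ∀ B ∈ F, ((n.choose B.card : ℝ))⁻¹ = ((prefixed B).card : ℝ) / n.factorial := by
    intro B _
    have hBn : B.card ≤ n := by simpa using B.card_le_univ
    rw [card_prefixed, Fintype.card_fin, Nat.cast_choose ℝ hBn, inv_div]
    push_cast
    rfl
  rw [Finset.sum_congr rfl h2, ← Finset.sum_div, div_le_iff₀ hn]
  exact_mod_cast h

end LYM

/-! ### Covers, levels, and double counting between adjacent levels. -/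

section Levels

variable {n : ℕ}

/-- The sets covering `A`. -/
def ups (A : Finset (Fin n)) : Finset (Finset (Fin n)) :=
  Aᶜ.image fun x => insert x A

/-- The sets covered by `A`. -/
def downs (A : Finset (Fin n)) : Finset (Finset (Fin n)) :=
  A.image fun x => A.erase x

theorem mem_ups {A B : Finset (Fin n)} : B ∈ ups A ↔ A ⊆ B ∧ B.card = A.card + 1 := by
  simp only [ups, Finset.mem_image, Finset.mem_compl]
  constructor
  · rintro ⟨x, hx, rfl⟩
    exact ⟨Finset.subset_insert _ _, Finset.card_insert_of_notMem hx⟩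
  · rintro ⟨hAB, hc⟩
    have h1 : (B \ A).card = 1 := by rw [Finset.card_sdiff_of_subset hAB]; omega
    obtain ⟨x, hx⟩ := Finset.card_eq_one.1 h1
    have hxm : x ∈ B \ A := by rw [hx]; exact Finset.mem_singleton_self x
    refine ⟨x, (Finset.mem_sdiff.1 hxm).2, ?_⟩
    rw [Finset.insert_eq, ← hx, Finset.sdiff_union_of_subset hAB]

theorem mem_downs {A B : Finset (Fin n)} : B ∈ downs A ↔ B ⊆ A ∧ A.card = B.card + 1 := by
  simp only [downs, Finset.mem_image]
  constructor
  · rintro ⟨x, hx, rfl⟩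
    exact ⟨Finset.erase_subset _ _, (Finset.card_erase_add_one hx).symm⟩
  · intro h
    obtain ⟨x, hx, rfl⟩ : ∃ x ∉ B, insert x B = A := by
      have := mem_ups.2 h
      simpa [ups] using this
    exact ⟨x, Finset.mem_insert_self _ _, Finset.erase_insert hx⟩

theorem card_ups (A : Finset (Fin n)) : (ups A).card = n - A.card := by
  rw [ups, Finset.card_image_of_injOn, Finset.card_compl, Fintype.card_fin]
  intro x hx y _ h
  have : x ∈ insert y A := by
    change insert x A = insert y A at h
    rw [← h]; exact Finset.mem_insert_self _ _
  rcases Finset.mem_insert.1 this with h | h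
  · exact h
  · simp only [Finset.coe_compl, Set.mem_compl_iff, Finset.mem_coe] at hx
    exact absurd h hx

theorem card_downs (A : Finset (Fin n)) : (downs A).card = A.card := by
  rw [downs, Finset.card_image_of_injOn]
  intro x hx y _ h
  by_contra hne
  have : x ∈ A.erase y := Finset.mem_erase.2 ⟨hne, hx⟩
  change A.erase x = A.erase y at h
  rw [← h] at this
  exact Finset.notMem_erase x A this

theorem card_ups_inter_le (A : Finset (Fin n)) (Z : Finset (Finset (Fin n))) :
    (ups A ∩ Z).card ≤ cubeDegree Z A := by
  have : ups A ∩ Z ⊆ (Finset.univ.filter fun x => symmDiff A {x} ∈ Z).image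
      fun x => symmDiff A {x} := by
    intro B hB
    obtain ⟨h1, h2⟩ := Finset.mem_inter.1 hB
    obtain ⟨x, hx, rfl⟩ := Finset.mem_image.1 h1
    have he : symmDiff A {x} = insert x A := by
      ext y
      rw [mem_symmDiff_singleton, Finset.mem_insert]
      have := Finset.mem_compl.1 hx
      by_cases hy : y = x
      · subst hy; tauto
      · tauto
    refine Finset.mem_image.2 ⟨x, ?_, he⟩
    rw [Finset.mem_filter, he]
    exact ⟨Finset.mem_univ _, h2⟩
  exact (Finset.card_le_card this).trans Finset.card_image_le

/-- The sets of size `k` or `k + 1`. -/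
def layers (n k : ℕ) : Finset (Finset (Fin n)) :=
  Finset.univ.filter fun A => A.card = k ∨ A.card = k + 1

theorem mem_layers {k : ℕ} {A : Finset (Fin n)} :
    A ∈ layers n k ↔ A.card = k ∨ A.card = k + 1 := by
  simp [layers]

theorem card_filter_card_eq (n k : ℕ) :
    ((Finset.univ : Finset (Finset (Fin n))).filter fun A => A.card = k).card = n.choose k := by
  have : ((Finset.univ : Finset (Finset (Fin n))).filter fun A => A.card = k)
      = Finset.powersetCard k Finset.univ := by
    ext A; simp [Finset.mem_powersetCard]
  rw [this, Finset.card_powersetCard, Finset.card_univ, Fintype.card_fin]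

theorem card_layers (n k : ℕ) : (layers n k).card = n.choose k + n.choose (k + 1) := by
  rw [layers, Finset.filter_or, Finset.card_union_of_disjoint, card_filter_card_eq,
    card_filter_card_eq]
  rw [Finset.disjoint_filter]
  intro A _ h1 h2
  omega

/-- Counting covering pairs between `U`, contained in level `k`, and level `k + 1`. -/
theorem sum_card_downs_inter (k : ℕ) (U : Finset (Finset (Fin n))) (hU : ∀ A ∈ U, A.card = k) :
    ∑ B ∈ Finset.univ.filter (fun B : Finset (Fin n) => B.card = k + 1), (downs B ∩ U).card
      = (n - k) * U.card := by
  have h := Finset.sum_card_bipartiteAbove_eq_sum_card_bipartiteBelow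
    (s := Finset.univ.filter (fun B : Finset (Fin n) => B.card = k + 1)) (t := U)
    (r := fun B A => A ⊆ B)
  have h1 : ∀ B ∈ Finset.univ.filter (fun B : Finset (Fin n) => B.card = k + 1),
      (downs B ∩ U).card = (Finset.bipartiteAbove (fun B A => A ⊆ B) U B).card := by
    intro B hB
    congr 1
    ext A
    rw [Finset.mem_inter, mem_downs, Finset.mem_bipartiteAbove]
    have := (Finset.mem_filter.1 hB).2
    constructor
    · rintro ⟨⟨h1, -⟩, h2⟩
      exact ⟨h2, h1⟩
    · rintro ⟨h1, h2⟩
      exact ⟨⟨h2, by rw [hU A h1, this]⟩, h1⟩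
  rw [Finset.sum_congr rfl h1, h]
  have h2 : ∀ A ∈ U, (Finset.bipartiteBelow (fun B A => A ⊆ B)
      (Finset.univ.filter (fun B : Finset (Fin n) => B.card = k + 1)) A).card = n - k := by
    intro A hA
    rw [← hU A hA, ← card_ups]
    congr 1
    ext B
    simp [Finset.mem_bipartiteBelow, mem_ups, and_comm]
  rw [Finset.sum_congr rfl h2, Finset.sum_const, smul_eq_mul, mul_comm]

/-- Counting covering pairs between level `k` and `V`, contained in level `k + 1`. -/
theorem sum_card_ups_inter (k : ℕ) (V : Finset (Finset (Fin n))) (hV : ∀ A ∈ V, A.card = k + 1) :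
    ∑ B ∈ Finset.univ.filter (fun B : Finset (Fin n) => B.card = k), (ups B ∩ V).card
      = (k + 1) * V.card := by
  have h := Finset.sum_card_bipartiteAbove_eq_sum_card_bipartiteBelow
    (s := Finset.univ.filter (fun B : Finset (Fin n) => B.card = k)) (t := V)
    (r := fun B A => B ⊆ A)
  have h1 : ∀ B ∈ Finset.univ.filter (fun B : Finset (Fin n) => B.card = k),
      (ups B ∩ V).card = (Finset.bipartiteAbove (fun B A => B ⊆ A) V B).card := by
    intro B hB
    congr 1
    ext A
    rw [Finset.mem_inter, mem_ups, Finset.mem_bipartiteAbove]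
    have := (Finset.mem_filter.1 hB).2
    constructor
    · rintro ⟨⟨h1, -⟩, h2⟩
      exact ⟨h2, h1⟩
    · rintro ⟨h1, h2⟩
      exact ⟨⟨h2, by rw [hV A h1, this]⟩, h1⟩
  rw [Finset.sum_congr rfl h1, h]
  have h2 : ∀ A ∈ V, (Finset.bipartiteBelow (fun B A => B ⊆ A)
      (Finset.univ.filter (fun B : Finset (Fin n) => B.card = k)) A).card = k + 1 := by
    intro A hA
    rw [← hV A hA, ← card_downs A]
    congr 1
    ext B
    have := hV A hA
    simp only [Finset.mem_bipartiteBelow, mem_downs, Finset.mem_filter, Finset.mem_univ, true_and]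
    constructor
    · rintro ⟨h1, h2⟩
      exact ⟨h2, by omega⟩
    · rintro ⟨h1, h2⟩
      exact ⟨by omega, h1⟩
  rw [Finset.sum_congr rfl h2, Finset.sum_const, smul_eq_mul, mul_comm]

end Levels

/-! ### Separators in the Johnson graph. -/

section Johnson

variable {α : Type*} [DecidableEq α] [Fintype α]

theorem exists_perm_image_eq {A B : Finset α} (h : A.card = B.card) :
    ∃ τ : Equiv.Perm α, A.image τ = B := by
  let e : {x // x ∈ A} ≃ {x // x ∈ B} := Finset.equivOfCardEq h
  refine ⟨e.extendSubtype, ?_⟩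
  refine Finset.eq_of_subset_of_card_le ?_ ?_
  · intro y hy
    obtain ⟨x, hx, rfl⟩ := Finset.mem_image.1 hy
    exact e.extendSubtype_mem x hx
  · rw [Finset.card_image_of_injective _ (Equiv.injective _), h]

/-- The permutations carrying a given `k`-set to another one are a fraction `1 / (n choose k)`
of all permutations. -/
theorem card_perm_image_eq_mul_choose {A B : Finset α} (h : A.card = B.card) :
    ((Finset.univ : Finset (Equiv.Perm α)).filter fun ρ : Equiv.Perm α => A.image ρ = B).card
      * (Fintype.card α).choose A.card = (Fintype.card α).factorial := by
  have hc : ∀ C ∈ Finset.powersetCard A.card (Finset.univ : Finset α),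
      ((Finset.univ : Finset (Equiv.Perm α)).filter fun ρ : Equiv.Perm α => A.image ρ = C).card
        = ((Finset.univ : Finset (Equiv.Perm α)).filter fun ρ : Equiv.Perm α => A.image ρ = B).card := by
    intro C hC
    obtain ⟨τ, hτ⟩ := exists_perm_image_eq (A := C) (B := B)
      (by rw [(Finset.mem_powersetCard.1 hC).2, h])
    refine Finset.card_bij' (fun ρ _ => τ * ρ) (fun ρ _ => τ⁻¹ * ρ) ?_ ?_ ?_ ?_
    · intro ρ hρ
      simp only [Finset.mem_filter, Finset.mem_univ, true_and] at hρ ⊢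
      rw [Equiv.Perm.coe_mul, ← Finset.image_image, hρ, hτ]
    · intro ρ hρ
      simp only [Finset.mem_filter, Finset.mem_univ, true_and] at hρ ⊢
      rw [Equiv.Perm.coe_mul, ← Finset.image_image, hρ, ← hτ, Finset.image_image,
        ← Equiv.Perm.coe_mul, inv_mul_cancel, Equiv.Perm.coe_one, Finset.image_id]
    · intro ρ _; simp
    · intro ρ _; simp
  have hs := Finset.card_eq_sum_card_fiberwise (s := (Finset.univ : Finset (Equiv.Perm α)))
    (t := Finset.powersetCard A.card (Finset.univ : Finset α)) (f := fun ρ : Equiv.Perm α => A.image ρ) (by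
      intro ρ _
      simp [Finset.mem_powersetCard, Finset.card_image_of_injective _ (Equiv.injective ρ)])
  rw [Finset.sum_congr rfl hc, Finset.sum_const, Finset.card_powersetCard, Finset.card_univ,
    Finset.card_univ, Fintype.card_perm, smul_eq_mul] at hs
  rw [hs, mul_comm]

/-- A set separating `S` from `T` in the Johnson graph cannot be small. -/
theorem card_mul_card_le_of_separated {k : ℕ} {S T W : Finset (Finset α)}
    (hS : ∀ A ∈ S, A.card = k) (hT : ∀ A ∈ T, A.card = k) (hdis : Disjoint S T)
    (hcov : ∀ A : Finset α, A.card = k → A ∈ S ∨ A ∈ T ∨ A ∈ W)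
    (hsep : ∀ A ∈ S, ∀ x y, A.image (Equiv.swap x y) ∉ T) :
    S.card * T.card ≤ Fintype.card α * W.card * (Fintype.card α).choose k := by
  -- Peel transpositions off `ρ`. The resulting path from a set of `S` to a set of `T` cannot jump
  -- directly from `S` to `T`, so it meets `W`; each intermediate permutation is injective and sends
  -- at most |W| sets into `W`.
  have step : ∀ (c : ℕ) (ρ : Equiv.Perm α), ρ.support.card ≤ c →
      (S.filter fun A => A.image ρ ∈ T).card ≤ c * W.card := by
    intro c
    induction c with
    | zero =>
      intro ρ hρ
      have : ρ = 1 := by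
        rw [← Equiv.Perm.support_eq_empty_iff]
        exact Finset.card_eq_zero.1 (by omega)
      subst this
      rw [zero_mul, Nat.le_zero, Finset.card_eq_zero, Finset.filter_eq_empty_iff]
      intro A hA hAT
      rw [Equiv.Perm.coe_one, Finset.image_id] at hAT
      exact Finset.disjoint_left.1 hdis hA hAT
    | succ c ih =>
      intro ρ hρ
      by_cases h1 : ρ = 1
      · exact (ih ρ (by simp [h1])).trans (Nat.mul_le_mul_right _ (Nat.le_succ c))
      · obtain ⟨x, hx⟩ : ∃ x, ρ x ≠ x := by
          by_contra hcon
          push Not at hcon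
          exact h1 (Equiv.ext hcon)
        set ρ' := Equiv.swap x (ρ x) * ρ with hρ'
        have hcard := Equiv.Perm.card_support_swap_mul hx
        have ih' := ih ρ' (by rw [hρ']; omega)
        have hρeq : ρ = Equiv.swap x (ρ x) * ρ' := by rw [hρ', Equiv.swap_mul_self_mul]
        have hsub : (S.filter fun A => A.image ρ ∈ T) ⊆
            (S.filter fun A => A.image ρ' ∈ T) ∪ (S.filter fun A => A.image ρ' ∈ W) := by
          intro A hA
          obtain ⟨hAS, hAT⟩ := Finset.mem_filter.1 hA
          have hk : (A.image ρ').card = k := by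
            rw [Finset.card_image_of_injective _ (Equiv.injective _), hS A hAS]
          rcases hcov _ hk with h | h | h
          · exfalso
            refine hsep _ h x (ρ x) ?_
            rw [Finset.image_image, ← Equiv.Perm.coe_mul, ← hρeq]
            exact hAT
          · exact Finset.mem_union_left _ (Finset.mem_filter.2 ⟨hAS, h⟩)
          · exact Finset.mem_union_right _ (Finset.mem_filter.2 ⟨hAS, h⟩)
        have hW : (S.filter fun A => A.image ρ' ∈ W).card ≤ W.card := by
          refine Finset.card_le_card_of_injOn (fun A => A.image ρ') ?_ ?_
          · intro A hA
            exact (Finset.mem_filter.1 hA).2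
          · intro A _ B _ h
            exact Finset.image_injective (Equiv.injective ρ') h
        have := (Finset.card_le_card hsub).trans (Finset.card_union_le _ _)
        rw [Nat.succ_mul]
        omega
  have hstep : ∀ ρ : Equiv.Perm α,
      (S.filter fun A => A.image ρ ∈ T).card ≤ Fintype.card α * W.card :=
    fun ρ => step _ ρ (Finset.card_le_univ _)
  have hsum := Finset.sum_le_sum fun ρ (_ : ρ ∈ Finset.univ) => hstep ρ
  rw [Finset.sum_const, Finset.card_univ, Fintype.card_perm, smul_eq_mul] at hsum
  -- Averaged over all permutations, a given set of `S` is carried to a given set of `T` with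
  -- probability 1 / C(N,k), where N is the size of the ground set.
  have hcount : (∑ ρ : Equiv.Perm α, (S.filter fun A => A.image ρ ∈ T).card)
      * (Fintype.card α).choose k = S.card * T.card * (Fintype.card α).factorial := by
    have e1 : ∀ ρ : Equiv.Perm α, (S.filter fun A => A.image ρ ∈ T).card
        = ∑ A ∈ S, ∑ B ∈ T, if A.image ρ = B then 1 else 0 := by
      intro ρ
      rw [Finset.card_filter]
      refine Finset.sum_congr rfl fun A _ => ?_
      rw [Finset.sum_ite_eq]
    rw [Finset.sum_congr rfl fun ρ _ => e1 ρ, Finset.sum_comm, Finset.sum_mul]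
    have e2 : ∀ A ∈ S, (∑ ρ : Equiv.Perm α, ∑ B ∈ T, if A.image ρ = B then 1 else 0)
        * (Fintype.card α).choose k = T.card * (Fintype.card α).factorial := by
      intro A hA
      rw [Finset.sum_comm, Finset.sum_mul, ← smul_eq_mul T.card, ← Finset.sum_const]
      refine Finset.sum_congr rfl fun B hB => ?_
      rw [← card_perm_image_eq_mul_choose (A := A) (B := B) (by rw [hS A hA, hT B hB]),
        Finset.card_filter, hS A hA]
    rw [Finset.sum_congr rfl e2, Finset.sum_const, smul_eq_mul, mul_assoc]
  have hfac : 0 < (Fintype.card α).factorial := Nat.factorial_pos _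
  refine Nat.le_of_mul_le_mul_right ?_ hfac
  rw [← hcount]
  calc _ ≤ ((Fintype.card α).factorial * (Fintype.card α * W.card))
        * (Fintype.card α).choose k := Nat.mul_le_mul_right _ hsum
    _ = _ := by ring

end Johnson

/-! ### Unimodality of the binomial coefficients. -/

section Weights

theorem choose_le_choose_of_le_half {n i j : ℕ} (hij : i ≤ j) (hj : 2 * j ≤ n + 1) :
    n.choose i ≤ n.choose j := by
  induction j, hij using Nat.le_induction with
  | base => exact le_rfl
  | succ j _ ih =>
    refine (ih (by omega)).trans ?_
    have h1 := Nat.choose_succ_right_eq n j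
    have h2 : n.choose j * (j + 1) ≤ n.choose (j + 1) * (j + 1) := by
      rw [h1]
      exact Nat.mul_le_mul_left _ (by omega)
    exact Nat.le_of_mul_le_mul_right h2 (by omega)

theorem choose_le_choose_of_half_le {n i j : ℕ} (hij : i ≤ j) (hi : n ≤ 2 * i + 1) :
    n.choose j ≤ n.choose i := by
  induction j, hij using Nat.le_induction with
  | base => exact le_rfl
  | succ j _ ih =>
    refine le_trans ?_ ih
    have h1 := Nat.choose_succ_right_eq n j
    have h2 : n.choose (j + 1) * (j + 1) ≤ n.choose j * (j + 1) := by
      rw [h1]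
      exact Nat.mul_le_mul_left _ (by omega)
    exact Nat.le_of_mul_le_mul_right h2 (by omega)

end Weights

/-! ### Stability for odd n, from the weights alone. -/

section Odd

/-- Stability for butterfly-free families on an odd ground set. -/
theorem ButterflyFree.stability_odd {n m D : ℕ} (hn : n = 2 * m + 1) (hm : 1 ≤ m)
    {F : Finset (Finset (Fin n))} (hF : ButterflyFree F) (h0 : ∅ ∉ F)
    (h1 : Finset.univ ∉ F) (hD : sigmaTwo n ≤ F.card + D) :
    2 * (layers n m \ F).card ≤ (m + 2) * D := by
  set c := n.choose m with hc
  have hc' : n.choose (m + 1) = c := by rw [hc, hn, Nat.choose_symm_half]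
  have hcpos : 0 < c := Nat.choose_pos (by omega)
  have hsig : sigmaTwo n = 2 * c := by
    rw [sigmaTwo, show n / 2 = m by omega, hc', ← hc]; ring
  -- Off the two central levels a set weighs at least (m+2)/m times as much as a central one, with
  -- equality at levels m-1 and m+2. Members there waste LYM weight, so there are few of them.
  have hout : ∀ j, j ≤ n → j ≠ m → j ≠ m + 1 → (m + 2) * n.choose j ≤ m * c := by
    intro j hj h2 h3
    have h4 : n.choose (m + 2) * (m + 2) = c * m := by
      rw [Nat.choose_succ_right_eq n (m + 1), hc']
      congr 1; omega
    have h5 : n.choose j ≤ n.choose (m + 2) := by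
      rcases Nat.lt_or_ge j m with h | h
      · have h6 : n.choose (m + 2) = n.choose (m - 1) := by
          rw [← Nat.choose_symm (show m - 1 ≤ n by omega)]
          congr 1; omega
        rw [h6]
        exact choose_le_choose_of_le_half (by omega) (by omega)
      · exact choose_le_choose_of_half_le (by omega) (by omega)
    nlinarith
  have hL := hF.sum_inv_choose_le h0 h1
  set I := F ∩ layers n m with hI
  set O := F \ layers n m with hO
  have hsplit : I.card + O.card = F.card := Finset.card_inter_add_card_sdiff F (layers n m)
  have hcR : (0 : ℝ) < c := by exact_mod_cast hcpos
  have hmR : (0 : ℝ) < m := by exact_mod_cast hm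
  have hsum : (I.card : ℝ) * (1 / c) + O.card * ((m + 2) / (m * c)) ≤ 2 := by
    refine le_trans ?_ hL
    have hunion : I ∪ O = F := by
      rw [hI, hO, Finset.union_comm, Finset.sdiff_union_inter]
    rw [← hunion, Finset.sum_union (Finset.disjoint_sdiff_inter F (layers n m)).symm,
      ← nsmul_eq_mul, ← nsmul_eq_mul,
      ← Finset.sum_const, ← Finset.sum_const]
    refine add_le_add (Finset.sum_le_sum fun B hB => ?_) (Finset.sum_le_sum fun B hB => ?_)
    · have := mem_layers.1 (Finset.mem_inter.1 hB).2
      rcases this with h | h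
      · rw [h, one_div]
      · rw [h, hc', one_div]
    · have hB' := (Finset.mem_sdiff.1 hB).2
      rw [mem_layers, not_or] at hB'
      have hBn : B.card ≤ n := by simpa using B.card_le_univ
      have h2 := hout B.card hBn hB'.1 hB'.2
      have h3 : (0 : ℝ) < n.choose B.card := by exact_mod_cast Nat.choose_pos hBn
      rw [inv_eq_one_div, div_le_div_iff₀ (by positivity) h3, one_mul]
      exact_mod_cast h2
  have hsum2 : m * I.card + (m + 2) * O.card ≤ 2 * m * c := by
    have h2 : ((I.card : ℝ) * (1 / c) + O.card * ((m + 2) / (m * c))) * (m * c)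
        = m * I.card + (m + 2) * O.card := by field_simp
    have h3 := mul_le_mul_of_nonneg_right hsum (show (0 : ℝ) ≤ m * c by positivity)
    rw [h2] at h3
    have h4 : (m : ℝ) * I.card + (m + 2) * O.card ≤ 2 * m * c := by linarith
    exact_mod_cast h4
  have hmiss : (layers n m \ F).card + I.card = 2 * c := by
    have h2 := Finset.card_inter_add_card_sdiff (layers n m) F
    rw [card_layers, hc', ← hc, Finset.inter_comm, ← hI] at h2
    omega
  rw [hsig] at hD
  have h5 : 2 * O.card ≤ m * D := by nlinarith
  nlinarith

end Odd

/-! ### Even n: the weights of the three central levels. -/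

section Even

variable {n : ℕ}

theorem ButterflyFree.card_downs_inter_le_one {F : Finset (Finset (Fin n))} (hF : ButterflyFree F)
    {B : Finset (Fin n)} (hB : B ∈ F) (hu : 1 ≤ (ups B ∩ F).card) : (downs B ∩ F).card ≤ 1 := by
  obtain ⟨C, hC⟩ := Finset.card_pos.1 hu
  obtain ⟨hC1, hC2⟩ := Finset.mem_inter.1 hC
  have hBC : B ⊂ C := by
    refine (mem_ups.1 hC1).1.ssubset_of_ne fun h => ?_
    have := (mem_ups.1 hC1).2
    rw [h] at this; omega
  refine Finset.card_le_one.2 fun A hA A' hA' => ?_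
  by_contra hne
  have hlt : ∀ A ∈ downs B ∩ F, A ⊂ B := by
    intro A hA
    refine (mem_downs.1 (Finset.mem_inter.1 hA).1).1.ssubset_of_ne fun h => ?_
    have := (mem_downs.1 (Finset.mem_inter.1 hA).1).2
    rw [h] at this; omega
  exact hF A (Finset.mem_inter.1 hA).2 A' (Finset.mem_inter.1 hA').2 B hB C hC2 hne hBC.ne
    (hlt A hA) ((hlt A hA).trans hBC) (hlt A' hA') ((hlt A' hA').trans hBC)

/-- If a set of `F` has two covers in `F`, every set it covers is outside `F`. -/
theorem ButterflyFree.card_downs_inter_eq_zero {F : Finset (Finset (Fin n))}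
    (hF : ButterflyFree F) {B : Finset (Fin n)} (hB : B ∈ F) (hu : 2 ≤ (ups B ∩ F).card) :
    (downs B ∩ F).card = 0 := by
  obtain ⟨C, hC, C', hC', hne⟩ := Finset.one_lt_card.1 hu
  have hlt : ∀ C ∈ ups B ∩ F, B ⊂ C := by
    intro C hC
    refine (mem_ups.1 (Finset.mem_inter.1 hC).1).1.ssubset_of_ne fun h => ?_
    have := (mem_ups.1 (Finset.mem_inter.1 hC).1).2
    rw [h] at this; omega
  by_contra hcon
  obtain ⟨A, hA⟩ := Finset.card_pos.1 (Nat.pos_of_ne_zero hcon)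
  have hAB : A ⊂ B := by
    refine (mem_downs.1 (Finset.mem_inter.1 hA).1).1.ssubset_of_ne fun h => ?_
    have := (mem_downs.1 (Finset.mem_inter.1 hA).1).2
    rw [h] at this; omega
  exact hF A (Finset.mem_inter.1 hA).2 B hB C (Finset.mem_inter.1 hC).2 C'
    (Finset.mem_inter.1 hC').2 hAB.ne hne (hAB.trans (hlt C hC)) (hAB.trans (hlt C' hC'))
    (hlt C hC) (hlt C' hC')

/-- Weighing the middle three levels: few sets of the middle level are missing, and few sets are
outside the three levels. -/
theorem ButterflyFree.weights_even {m D : ℕ} (hn : n = 2 * m) (hm : 2 ≤ m)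
    {F : Finset (Finset (Fin n))} (hF : ButterflyFree F) (h0 : ∅ ∉ F)
    (h1 : Finset.univ ∉ F) (hD : sigmaTwo n ≤ F.card + D) :
    (m - 1) * (n.choose m - (F.filter fun A => A.card = m).card)
      + 3 * (m + 1) * (F.filter fun A => A.card ≠ m ∧ A.card ≠ m - 1 ∧ A.card ≠ m + 1).card
      ≤ (m - 1) * (m + 1) * D := by
  obtain ⟨p, rfl⟩ : ∃ p, m = p + 1 := ⟨m - 1, by omega⟩
  set a := n.choose (p + 1) with ha
  set b := n.choose (p + 2) with hb
  have hbpos : 0 < b := Nat.choose_pos (by omega)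
  have hapos : 0 < a := Nat.choose_pos (by omega)
  have hab : b * (p + 2) = a * (p + 1) := by
    rw [hb, ha, Nat.choose_succ_right_eq]; congr 1; omega
  have hb' : n.choose p = b := by
    rw [hb, ← Nat.choose_symm (show p ≤ n by omega)]; congr 1; omega
  have hsig : sigmaTwo n = a + b := by
    rw [sigmaTwo, show n / 2 = p + 1 by omega]
  -- With m = p+1, levels p and p+2 weigh 1/b and the middle level slightly less. Sets beyond these
  -- three weigh at least (p+3)/(p b).
  have hout : ∀ j, j ≤ n → j ≠ p + 1 → j ≠ p → j ≠ p + 2 → (p + 3) * n.choose j ≤ p * b := by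
    intro j hj h2 h3 h3'
    have h4 : n.choose (p + 3) * (p + 3) = b * p := by
      rw [Nat.choose_succ_right_eq n (p + 2), ← hb]; congr 1; omega
    have h5 : n.choose j ≤ n.choose (p + 3) := by
      rcases Nat.lt_or_ge j p with h | h
      · have h6 : n.choose (p + 3) = n.choose (p - 1) := by
          rw [← Nat.choose_symm (show p - 1 ≤ n by omega)]
          congr 1; omega
        rw [h6]
        exact choose_le_choose_of_le_half (by omega) (by omega)
      · exact choose_le_choose_of_half_le (by omega) (by omega)
    nlinarith
  have hL := hF.sum_inv_choose_le h0 h1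
  set X := F.filter fun A => A.card = p + 1 with hX
  set O := F.filter fun A => A.card ≠ p + 1 ∧ A.card ≠ p + 1 - 1 ∧ A.card ≠ p + 1 + 1 with hO
  set Y := F.filter fun A => A.card = p ∨ A.card = p + 2 with hY
  have hXY : Disjoint X Y := by
    rw [hX, hY, Finset.disjoint_filter]; intro A _ h2 h3; omega
  have hXYO : Disjoint (X ∪ Y) O := by
    rw [hX, hY, hO, ← Finset.filter_or, Finset.disjoint_filter]; intro A _ h2 h3; omega
  have hU : (X ∪ Y) ∪ O = F := by
    rw [hX, hY, hO, ← Finset.filter_or, ← Finset.filter_or, Finset.filter_true_of_mem]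
    intro A _; omega
  have hcard : X.card + Y.card + O.card = F.card := by
    rw [← hU, Finset.card_union_of_disjoint hXYO, Finset.card_union_of_disjoint hXY]
  have haR : (0 : ℝ) < a := by exact_mod_cast hapos
  have hbR : (0 : ℝ) < b := by exact_mod_cast hbpos
  have hp : 1 ≤ p := by omega
  have hpR : (0 : ℝ) < p := by exact_mod_cast hp
  have habR : (b : ℝ) * (p + 2) = a * (p + 1) := by exact_mod_cast hab
  have hsum : (X.card : ℝ) * ((p + 1) / ((p + 2) * b)) + Y.card * (1 / b)
      + O.card * ((p + 3) / (p * b)) ≤ 2 := by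
    refine le_trans ?_ hL
    rw [← hU, Finset.sum_union hXYO, Finset.sum_union hXY, ← nsmul_eq_mul, ← nsmul_eq_mul,
      ← nsmul_eq_mul, ← Finset.sum_const, ← Finset.sum_const, ← Finset.sum_const]
    refine add_le_add (add_le_add (Finset.sum_le_sum fun B hB => ?_)
      (Finset.sum_le_sum fun B hB => ?_)) (Finset.sum_le_sum fun B hB => ?_)
    · rw [(Finset.mem_filter.1 hB).2, ← ha, inv_eq_one_div,
        div_le_div_iff₀ (by positivity) haR]
      linarith
    · rcases (Finset.mem_filter.1 hB).2 with h | h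
      · rw [h, hb', one_div]
      · rw [h, one_div]
    · have hB' := (Finset.mem_filter.1 hB).2
      have hBn : B.card ≤ n := by simpa using B.card_le_univ
      have h2 := hout B.card hBn hB'.1 (by omega) (by omega)
      have h3 : (0 : ℝ) < n.choose B.card := by exact_mod_cast Nat.choose_pos hBn
      rw [inv_eq_one_div, div_le_div_iff₀ (by positivity) h3, one_mul]
      exact_mod_cast h2
  have hsum2 : p * (p + 1) * X.card + p * (p + 2) * Y.card + (p + 3) * (p + 2) * O.card
      ≤ 2 * (p * (p + 2)) * b := by
    have h2 : ((X.card : ℝ) * ((p + 1) / ((p + 2) * b)) + Y.card * (1 / b)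
        + O.card * ((p + 3) / (p * b))) * (p * (p + 2) * b)
        = p * (p + 1) * X.card + p * (p + 2) * Y.card + (p + 3) * (p + 2) * O.card := by
      field_simp
    have h3 := mul_le_mul_of_nonneg_right hsum (show (0 : ℝ) ≤ p * (p + 2) * b by positivity)
    rw [h2] at h3
    have h4 : (p : ℝ) * (p + 1) * X.card + p * (p + 2) * Y.card + (p + 3) * (p + 2) * O.card
        ≤ 2 * (p * (p + 2)) * b := by linarith
    exact_mod_cast h4
  have hXa : X.card ≤ a := by
    rw [ha, ← card_filter_card_eq]
    exact Finset.card_le_card (Finset.filter_subset_filter _ (Finset.subset_univ F))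
  rw [hsig] at hD
  obtain ⟨r, hr⟩ : ∃ r, a = X.card + r := ⟨a - X.card, by omega⟩
  have h6 : a - X.card = r := by omega
  rw [h6]
  simp only [Nat.add_sub_cancel]
  have h7 : p * (p + 2) * (X.card + r + b) ≤ p * (p + 2) * (X.card + Y.card + O.card + D) :=
    Nat.mul_le_mul_left _ (by omega)
  have h8 : p * (b * (p + 2)) = p * ((X.card + r) * (p + 1)) := by rw [hab, hr]
  nlinarith

end Even

/-! ### Even n: deciding between the two outer levels. -/

section Even

variable {n : ℕ}

/-- Almost every set of the middle level has either all the sets it covers or all its covers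
in `F`; the exceptional sets form `W`. -/
theorem ButterflyFree.exists_partition_even {m D : ℕ} (hn : n = 2 * m) (hm : 3 ≤ m)
    {F : Finset (Finset (Fin n))} (hF : ButterflyFree F) (h0 : ∅ ∉ F)
    (h1 : Finset.univ ∉ F) (hD : sigmaTwo n ≤ F.card + D) :
    ∃ S T W : Finset (Finset (Fin n)), ∃ t : ℕ,
      (∀ A ∈ S, A.card = m ∧ (downs A ∩ F).card = m ∧ (ups A ∩ F).card = 0) ∧
      (∀ A ∈ T, A.card = m ∧ (downs A ∩ F).card = 0 ∧ (ups A ∩ F).card = m) ∧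
      (∀ A : Finset (Fin n), A.card = m → A ∈ S ∨ A ∈ T ∨ A ∈ W) ∧
      W.card ≤ (m + 1) * (D + t) ∧ 3 * t ≤ (m - 1) * D ∧
      (layers n m \ F).card ≤ D + t + (F.filter fun A => A.card = m - 1).card ∧
      (layers n (m - 1) \ F).card ≤ D + t + (F.filter fun A => A.card = m + 1).card := by
  have hw := hF.weights_even hn (by omega) h0 h1 hD
  set X := F.filter fun A => A.card = m with hX
  set U := F.filter fun A => A.card = m - 1 with hU
  set V := F.filter fun A => A.card = m + 1 with hV
  set O := F.filter fun A => A.card ≠ m ∧ A.card ≠ m - 1 ∧ A.card ≠ m + 1 with hO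
  set L := (Finset.univ : Finset (Finset (Fin n))).filter fun A => A.card = m with hL
  set a := n.choose m with ha
  set b := n.choose (m + 1) with hb
  have hLa : L.card = a := card_filter_card_eq n m
  have hXL : X ⊆ L := Finset.filter_subset_filter _ (Finset.subset_univ F)
  have hab : b * (m + 1) = a * m := by
    rw [hb, ha, Nat.choose_succ_right_eq]; congr 1; omega
  have hb' : n.choose (m - 1) = b := by
    rw [hb, ← Nat.choose_symm (show m - 1 ≤ n by omega)]; congr 1; omega
  have hsig : sigmaTwo n = a + b := by
    rw [sigmaTwo, show n / 2 = m by omega]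
  rw [hsig] at hD
  have hFc : X.card + U.card + V.card + O.card = F.card := by
    have e1 : Disjoint X U := by
      rw [hX, hU, Finset.disjoint_filter]; intro A _ h2 h3; omega
    have e2 : Disjoint (X ∪ U) V := by
      rw [hX, hU, hV, ← Finset.filter_or, Finset.disjoint_filter]; intro A _ h2 h3; omega
    have e3 : Disjoint (X ∪ U ∪ V) O := by
      rw [hX, hU, hV, hO, ← Finset.filter_or, ← Finset.filter_or, Finset.disjoint_filter]
      intro A _ h2 h3; omega
    rw [← Finset.card_union_of_disjoint e1, ← Finset.card_union_of_disjoint e2,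
      ← Finset.card_union_of_disjoint e3]
    congr 1
    rw [hX, hU, hV, hO, ← Finset.filter_or, ← Finset.filter_or, ← Finset.filter_or,
      Finset.filter_true_of_mem]
    intro A _; omega
  have hd : ∀ A ∈ L, (downs A ∩ F).card = (downs A ∩ U).card := by
    intro A hA
    congr 1
    ext B
    have := (Finset.mem_filter.1 hA).2
    simp only [Finset.mem_inter, mem_downs, hU, Finset.mem_filter]
    constructor
    · rintro ⟨⟨h2, h3⟩, h4⟩; exact ⟨⟨h2, h3⟩, h4, by omega⟩
    · rintro ⟨h2, h3, -⟩; exact ⟨h2, h3⟩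
  have hu : ∀ A ∈ L, (ups A ∩ F).card = (ups A ∩ V).card := by
    intro A hA
    congr 1
    ext B
    have := (Finset.mem_filter.1 hA).2
    simp only [Finset.mem_inter, mem_ups, hV, Finset.mem_filter]
    constructor
    · rintro ⟨⟨h2, h3⟩, h4⟩; exact ⟨⟨h2, h3⟩, h4, by omega⟩
    · rintro ⟨h2, h3, -⟩; exact ⟨h2, h3⟩
  have hdm : ∀ A ∈ L, (downs A ∩ F).card ≤ m := fun A hA =>
    (Finset.card_le_card Finset.inter_subset_left).trans
      (by rw [card_downs, (Finset.mem_filter.1 hA).2])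
  have hum : ∀ A ∈ L, (ups A ∩ F).card ≤ m := fun A hA =>
    (Finset.card_le_card Finset.inter_subset_left).trans
      (by rw [card_ups, (Finset.mem_filter.1 hA).2]; omega)
  have hdsum : ∑ A ∈ L, (downs A ∩ F).card = (m + 1) * U.card := by
    rw [Finset.sum_congr rfl hd]
    have := sum_card_downs_inter (m - 1) U (fun A hA => (Finset.mem_filter.1 hA).2)
    rw [show m - 1 + 1 = m by omega, show n - (m - 1) = m + 1 by omega] at this
    exact this
  have husum : ∑ A ∈ L, (ups A ∩ F).card = (m + 1) * V.card := by
    rw [Finset.sum_congr rfl hu]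
    exact sum_card_ups_inter m V (fun A hA => (Finset.mem_filter.1 hA).2)
  -- Two covers in `F` force no lower neighbours in `F`, and one cover allows at most one. Since m ≥
  -- 3, the total m is reached only as m + 0 or 0 + m.
  have hdu : ∀ A ∈ X, (downs A ∩ F).card + (ups A ∩ F).card ≤ m ∧
      ((downs A ∩ F).card + (ups A ∩ F).card = m →
        ((downs A ∩ F).card = m ∧ (ups A ∩ F).card = 0) ∨
        ((downs A ∩ F).card = 0 ∧ (ups A ∩ F).card = m)) := by
    intro A hA
    have hAF := (Finset.mem_filter.1 hA).1
    have h2 := hdm A (hXL hA)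
    have h3 := hum A (hXL hA)
    have h4 := hF.card_downs_inter_le_one hAF
    have h5 := hF.card_downs_inter_eq_zero hAF
    omega
  set S := L.filter fun A => (downs A ∩ F).card = m ∧ (ups A ∩ F).card = 0 with hS
  set T := L.filter fun A => (downs A ∩ F).card = 0 ∧ (ups A ∩ F).card = m with hT
  set W' := X.filter fun A => (downs A ∩ F).card + (ups A ∩ F).card < m with hW'
  have hW'c : W'.card + ∑ A ∈ X, ((downs A ∩ F).card + (ups A ∩ F).card) ≤ m * X.card := by
    rw [hW', Finset.card_filter, ← Finset.sum_add_distrib, mul_comm, ← smul_eq_mul,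
      ← Finset.sum_const]
    refine Finset.sum_le_sum fun A hA => ?_
    have := (hdu A hA).1
    split_ifs <;> omega
  have hsplit : ∑ A ∈ L, ((downs A ∩ F).card + (ups A ∩ F).card)
      ≤ ∑ A ∈ X, ((downs A ∩ F).card + (ups A ∩ F).card) + (L \ X).card * (2 * m) := by
    rw [← Finset.sum_sdiff hXL, add_comm]
    refine Nat.add_le_add_left ?_ _
    rw [← smul_eq_mul, ← Finset.sum_const]
    refine Finset.sum_le_sum fun A hA => ?_
    have h2 := hdm A (Finset.mem_sdiff.1 hA).1
    have h3 := hum A (Finset.mem_sdiff.1 hA).1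
    omega
  rw [Finset.sum_add_distrib, hdsum, husum] at hsplit
  have hLX : (L \ X).card = a - X.card := by
    rw [Finset.card_sdiff_of_subset hXL, hLa]
  have hXa : X.card ≤ a := by rw [← hLa]; exact Finset.card_le_card hXL
  have hmiss : ∀ (k : ℕ) (Y : Finset (Finset (Fin n))), Y ⊆ layers n k → Y ⊆ F →
      (layers n k \ F).card + Y.card ≤ n.choose k + n.choose (k + 1) := by
    intro k Y hY1 hY2
    rw [← card_layers, ← Finset.card_union_of_disjoint]
    · exact Finset.card_le_card (Finset.union_subset Finset.sdiff_subset hY1)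
    · exact Finset.disjoint_left.2 fun A h2 h3 => (Finset.mem_sdiff.1 h2).2 (hY2 h3)
  refine ⟨S, T, (L \ X) ∪ W', O.card, ?_, ?_, ?_, ?_, ?_, ?_, ?_⟩
  · intro A hA
    obtain ⟨h2, h3⟩ := Finset.mem_filter.1 hA
    exact ⟨(Finset.mem_filter.1 h2).2, h3⟩
  · intro A hA
    obtain ⟨h2, h3⟩ := Finset.mem_filter.1 hA
    exact ⟨(Finset.mem_filter.1 h2).2, h3⟩
  · intro A hA
    have hAL : A ∈ L := Finset.mem_filter.2 ⟨Finset.mem_univ _, hA⟩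
    by_cases hAX : A ∈ X
    · have h2 := hdu A hAX
      by_cases h3 : (downs A ∩ F).card + (ups A ∩ F).card = m
      · rcases h2.2 h3 with h4 | h4
        · exact Or.inl (Finset.mem_filter.2 ⟨hAL, h4⟩)
        · exact Or.inr (Or.inl (Finset.mem_filter.2 ⟨hAL, h4⟩))
      · exact Or.inr (Or.inr (Finset.mem_union_right _
          (Finset.mem_filter.2 ⟨hAX, lt_of_le_of_ne h2.1 h3⟩)))
    · exact Or.inr (Or.inr (Finset.mem_union_left _ (Finset.mem_sdiff.2 ⟨hAL, hAX⟩)))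
  -- Since (m+1)b = ma, the r missing middle sets contribute r + 2mr on one side and (2m+1)r on the
  -- other. These cancel, leaving only (m+1)(D + |O|).
  · refine (Finset.card_union_le _ _).trans ?_
    rw [hLX] at hsplit ⊢
    obtain ⟨r, hr⟩ : ∃ r, a = X.card + r := ⟨a - X.card, by omega⟩
    have h6 : a - X.card = r := by omega
    rw [h6] at hsplit ⊢
    have h7 : (m + 1) * (a + b) ≤ (m + 1) * (X.card + U.card + V.card + O.card + D) :=
      Nat.mul_le_mul_left _ (by omega)
    have h8 : a * m = (X.card + r) * m := by rw [hr]
    nlinarith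
  · have h6 : (m + 1) * (3 * O.card) ≤ (m + 1) * ((m - 1) * D) := by
      calc (m + 1) * (3 * O.card) = 3 * (m + 1) * O.card := by ring
        _ ≤ (m - 1) * (m + 1) * D := by omega
        _ = _ := by ring
    exact Nat.le_of_mul_le_mul_left h6 (by omega)
  · have := hmiss m (X ∪ V) (by
      intro A hA
      rcases Finset.mem_union.1 hA with h | h
      · exact mem_layers.2 (Or.inl (Finset.mem_filter.1 h).2)
      · exact mem_layers.2 (Or.inr (Finset.mem_filter.1 h).2))
      (Finset.union_subset (Finset.filter_subset _ _) (Finset.filter_subset _ _))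
    rw [Finset.card_union_of_disjoint (by
      rw [hX, hV, Finset.disjoint_filter]; intro A _ h2 h3; omega)] at this
    omega
  · have := hmiss (m - 1) (U ∪ X) (by
      intro A hA
      rcases Finset.mem_union.1 hA with h | h
      · exact mem_layers.2 (Or.inl (Finset.mem_filter.1 h).2)
      · exact mem_layers.2 (Or.inr (by have := (Finset.mem_filter.1 h).2; omega)))
      (Finset.union_subset (Finset.filter_subset _ _) (Finset.filter_subset _ _))
    rw [Finset.card_union_of_disjoint (by
      rw [hX, hU, Finset.disjoint_filter]; intro A _ h2 h3; omega), hb',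
      show m - 1 + 1 = m by omega] at this
    omega

/-- Stability for butterfly-free families on an even ground set. -/
theorem ButterflyFree.stability_even {m D : ℕ} (hn : n = 2 * m) (hm : 11 ≤ m)
    {F : Finset (Finset (Fin n))} (hF : ButterflyFree F) (h0 : ∅ ∉ F)
    (h1 : Finset.univ ∉ F) (hD : sigmaTwo n ≤ F.card + D) (hD2 : n ^ 3 * D ≤ 2 ^ n) :
    3 * (layers n m \ F).card ≤ n ^ 3 * D ∨ 3 * (layers n (m - 1) \ F).card ≤ n ^ 3 * D := by
  obtain ⟨S, T, W, t, hS, hT, hcov, hW, ht, hm1, hm2⟩ :=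
    hF.exists_partition_even hn (by omega) h0 h1 hD
  set a := n.choose m with ha
  have hdis : Disjoint S T := Finset.disjoint_left.2 fun A h2 h3 => by
    have := hS A h2; have := hT A h3; omega
  -- A set and its image under a transposition share a subset of size m-1. It belongs to `F` since
  -- all sets covered by a member of `S` do, but a member of `T` covers nothing in `F`.
  have hsep : ∀ A ∈ S, ∀ x y, A.image (Equiv.swap x y) ∉ T := by
    intro A hA x y hAT
    have hAS := hS A hA
    have hsub : downs A ⊆ F := by
      have h2 : downs A ∩ F = downs A := Finset.eq_of_subset_of_card_le Finset.inter_subset_left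
        (by rw [card_downs, hAS.1, hAS.2.1])
      rw [← h2]; exact Finset.inter_subset_right
    have hzero := (hT _ hAT).2.1
    have hcard := (hT _ hAT).1
    -- remove from `A` the one of `x`, `y` it contains
    obtain ⟨z, hz, hzs⟩ : ∃ z ∈ A, A.erase z ⊆ A.image (Equiv.swap x y) := by
      by_cases hxy : x ∈ A ↔ y ∈ A
      · have hsw : A ⊆ A.image (Equiv.swap x y) := by
          intro w hw
          refine Finset.mem_image.2 ⟨Equiv.swap x y w, ?_, Equiv.swap_apply_self x y w⟩
          by_cases hwx : w = x
          · rw [hwx, Equiv.swap_apply_left]; exact hxy.1 (hwx ▸ hw)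
          · by_cases hwy : w = y
            · rw [hwy, Equiv.swap_apply_right]; exact hxy.2 (hwy ▸ hw)
            · rwa [Equiv.swap_apply_of_ne_of_ne hwx hwy]
        obtain ⟨z, hz⟩ := Finset.card_pos.1 (show 0 < A.card by omega)
        exact ⟨z, hz, (Finset.erase_subset _ _).trans hsw⟩
      · have key : ∀ w v : Fin n, w ∈ A → v ∉ A → A.erase w ⊆ A.image (Equiv.swap w v) := by
          intro w v hw hv u hu
          obtain ⟨h2, h3⟩ := Finset.mem_erase.1 hu
          refine Finset.mem_image.2 ⟨u, h3, Equiv.swap_apply_of_ne_of_ne h2 ?_⟩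
          rintro rfl
          exact hv h3
        by_cases hx : x ∈ A
        · exact ⟨x, hx, key x y hx (by tauto)⟩
        · refine ⟨y, by tauto, ?_⟩
          rw [Equiv.swap_comm]
          exact key y x (by tauto) hx
    have hmem : A.erase z ∈ downs (A.image (Equiv.swap x y)) ∩ F := by
      refine Finset.mem_inter.2 ⟨mem_downs.2 ⟨hzs, ?_⟩, hsub (Finset.mem_image.2 ⟨z, hz, rfl⟩)⟩
      rw [hcard, Finset.card_erase_of_mem hz]; omega
    have := Finset.card_pos.2 ⟨_, hmem⟩
    omega
  have hJ := card_mul_card_le_of_separated (k := m) (W := W) (fun A hA => (hS A hA).1)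
    (fun A hA => (hT A hA).1) hdis hcov hsep
  rw [Fintype.card_fin, ← ha] at hJ
  have hSTW : a ≤ S.card + T.card + W.card := by
    rw [ha, ← card_filter_card_eq]
    refine (Finset.card_le_card (t := S ∪ T ∪ W) ?_).trans
      ((Finset.card_union_le _ _).trans (Nat.add_le_add_right (Finset.card_union_le _ _) _))
    intro A hA
    simpa [or_assoc] using hcov A (Finset.mem_filter.1 hA).2
  have hW3 : 3 * W.card ≤ (m + 1) * (m + 2) * D := by
    obtain ⟨p, rfl⟩ : ∃ p, m = p + 1 := ⟨m - 1, by omega⟩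
    simp only [Nat.add_sub_cancel] at ht
    nlinarith
  have hapos : 0 < a := Nat.choose_pos (by omega)
  -- Here `hD2` enters, through C(2m,m) ≥ 4^m / (2m). With `W` at most a third of the middle level,
  -- the larger of `S` and `T` fills at least a third, so the separator bound makes the smaller one
  -- at most 3n|W|.
  have hWa : 3 * W.card ≤ a := by
    have h4 : 4 ^ m ≤ 2 * m * a := by
      have := Nat.four_pow_le_two_mul_self_mul_centralBinom m (by omega)
      rw [Nat.centralBinom_eq_two_mul_choose, ← hn, ← ha] at this
      rwa [← hn]
    have h5 : (2 : ℕ) ^ n = 4 ^ m := by rw [hn, pow_mul]; norm_num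
    rw [h5] at hD2
    have h6 : n * ((m + 1) * (m + 2) * D) ≤ n * a := by
      calc n * ((m + 1) * (m + 2) * D) ≤ n ^ 3 * D := by
            rw [hn]
            have : (m + 1) * (m + 2) ≤ (2 * m) ^ 2 := by nlinarith
            calc 2 * m * ((m + 1) * (m + 2) * D) = ((m + 1) * (m + 2)) * (2 * m * D) := by ring
              _ ≤ (2 * m) ^ 2 * (2 * m * D) := Nat.mul_le_mul_right _ this
              _ = _ := by ring
        _ ≤ 2 * m * a := hD2.trans h4
        _ = n * a := by rw [hn]
    exact hW3.trans (Nat.le_of_mul_le_mul_left h6 (by omega))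
  -- the smaller of `S` and `T` is small, and then so is the corresponding outer level
  have hsmall : ∀ s u : ℕ, s * a ≤ 3 * (n * W.card * a) → (m + 1) * u ≤ m * (s + W.card) →
      3 * (D + t + u) ≤ n ^ 3 * D := by
    intro s u hs hu
    have h2 : s ≤ 3 * (n * W.card) := by
      refine Nat.le_of_mul_le_mul_right ?_ hapos
      linarith
    have h3 : u ≤ s + W.card := by
      have : (m + 1) * u ≤ (m + 1) * (s + W.card) :=
        hu.trans (Nat.mul_le_mul_right _ (Nat.le_succ m))
      exact Nat.le_of_mul_le_mul_left this (by omega)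
    have h4 : 3 * t ≤ m * D := ht.trans (Nat.mul_le_mul_right _ (Nat.sub_le _ _))
    have h5 : 3 * u ≤ (3 * n + 1) * ((m + 1) * (m + 2) * D) := by
      calc 3 * u ≤ (3 * n + 1) * (3 * W.card) := by linarith
        _ ≤ _ := Nat.mul_le_mul_left _ hW3
    -- A cubic with leading term 6m³ against 8m³; this is where m ≥ 11 is needed.
    have h6 : 3 + m + (3 * n + 1) * ((m + 1) * (m + 2)) ≤ n ^ 3 := by
      rw [hn]
      nlinarith [mul_le_mul hm (le_refl (m * m)) (by positivity) (by positivity)]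
    calc 3 * (D + t + u) ≤ (3 + m + (3 * n + 1) * ((m + 1) * (m + 2))) * D := by linarith
      _ ≤ n ^ 3 * D := Nat.mul_le_mul_right _ h6
  have hout : ∀ (P Q : Finset (Finset (Fin n))) (d : Finset (Fin n) → ℕ) (u : ℕ),
      (∀ A : Finset (Fin n), A.card = m → A ∈ P ∨ A ∈ Q ∨ A ∈ W) →
      (∀ A : Finset (Fin n), A.card = m → d A ≤ m) →
      (∀ A ∈ Q, d A = 0) → (m + 1) * u
        = ∑ A ∈ Finset.univ.filter (fun A : Finset (Fin n) => A.card = m), d A →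
      (m + 1) * u ≤ m * (P.card + W.card) := by
    intro P Q d u hcov' hd hdQ hu
    rw [hu]
    calc _ ≤ ∑ A ∈ Finset.univ.filter (fun A : Finset (Fin n) => A.card = m),
          (if A ∈ P ∪ W then m else 0) := by
          refine Finset.sum_le_sum fun A hA => ?_
          have hA' := (Finset.mem_filter.1 hA).2
          split_ifs with h
          · exact hd A hA'
          · rw [Finset.mem_union, not_or] at h
            have := hcov' A hA'
            exact (hdQ A (by tauto)).le
      _ ≤ (P ∪ W).card * m := by
          rw [← Finset.sum_filter, Finset.sum_const, smul_eq_mul]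
          refine Nat.mul_le_mul_right _ (Finset.card_le_card fun A hA => ?_)
          exact (Finset.mem_filter.1 hA).2
      _ ≤ _ := by
          rw [mul_comm]
          exact Nat.mul_le_mul_left _ (Finset.card_union_le _ _)
  have hdU : (m + 1) * (F.filter fun A => A.card = m - 1).card
      = ∑ A ∈ Finset.univ.filter (fun A : Finset (Fin n) => A.card = m),
        (downs A ∩ F.filter fun A => A.card = m - 1).card := by
    have := sum_card_downs_inter (m - 1) (F.filter fun A => A.card = m - 1)
      (fun A hA => (Finset.mem_filter.1 hA).2)
    rw [show m - 1 + 1 = m by omega, show n - (m - 1) = m + 1 by omega] at this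
    exact this.symm
  have huV : (m + 1) * (F.filter fun A => A.card = m + 1).card
      = ∑ A ∈ Finset.univ.filter (fun A : Finset (Fin n) => A.card = m),
        (ups A ∩ F.filter fun A => A.card = m + 1).card :=
    (sum_card_ups_inter m (F.filter fun A => A.card = m + 1)
      (fun A hA => (Finset.mem_filter.1 hA).2)).symm
  rcases le_total S.card T.card with hle | hle
  · left
    have hs : S.card * a ≤ 3 * (n * W.card * a) := by
      have h2 : a ≤ 3 * T.card := by omega
      calc S.card * a ≤ S.card * (3 * T.card) := Nat.mul_le_mul_left _ h2
        _ = 3 * (S.card * T.card) := by ring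
        _ ≤ _ := Nat.mul_le_mul_left _ hJ
    have hu := hout S T _ _ hcov (fun A hA => (Finset.card_le_card Finset.inter_subset_left).trans
      (by rw [card_downs, hA])) (fun A hA => Nat.le_zero.1 ((Finset.card_le_card
        (Finset.inter_subset_inter_left (Finset.filter_subset _ _))).trans (hT A hA).2.1.le)) hdU
    have := hsmall _ _ hs hu
    omega
  · right
    have hs : T.card * a ≤ 3 * (n * W.card * a) := by
      have h2 : a ≤ 3 * S.card := by omega
      calc T.card * a ≤ T.card * (3 * S.card) := Nat.mul_le_mul_left _ h2
        _ = 3 * (S.card * T.card) := by ring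
        _ ≤ _ := Nat.mul_le_mul_left _ hJ
    have hu := hout T S _ _ (fun A hA => by have := hcov A hA; tauto)
      (fun A hA => (Finset.card_le_card Finset.inter_subset_left).trans
      (by rw [card_ups, hA]; omega)) (fun A hA => Nat.le_zero.1 ((Finset.card_le_card
        (Finset.inter_subset_inter_left (Finset.filter_subset _ _))).trans (hS A hA).2.2.le)) huV
    have := hsmall _ _ hs hu
    omega

end Even

/-- A butterfly-free family that is almost as large as possible almost contains two consecutive
middle levels. -/
theorem ButterflyFree.stability {n D : ℕ} (hn : 22 ≤ n)
    {F : Finset (Finset (Fin n))} (hF : ButterflyFree F) (h0 : ∅ ∉ F)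
    (h1 : Finset.univ ∉ F) (hD : sigmaTwo n ≤ F.card + D) (hD2 : n ^ 3 * D ≤ 2 ^ n) :
    ∃ k, (n + 1) / 2 ≤ k + 1 ∧ (n + 1) / 2 + k ≤ n ∧ n.choose k + n.choose (k + 1) = sigmaTwo n ∧
      3 * (layers n k \ F).card ≤ n ^ 3 * D := by
  rcases Nat.even_or_odd' n with ⟨m, hm | hm⟩
  · rcases hF.stability_even hm (by omega) h0 h1 hD hD2 with h | h
    · exact ⟨m, by omega, by omega, by rw [sigmaTwo, show n / 2 = m by omega], h⟩
    · refine ⟨m - 1, by omega, by omega, ?_, h⟩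
      rw [sigmaTwo, show n / 2 = m by omega, show m - 1 + 1 = m by omega, add_comm,
        ← Nat.choose_symm (show m - 1 ≤ n by omega)]
      congr 2; omega
  · refine ⟨m, by omega, by omega, by rw [sigmaTwo, show n / 2 = m by omega], ?_⟩
    have h2 := hF.stability_odd hm (by omega) h0 h1 hD
    have h3 : 3 * (m + 2) ≤ 2 * n ^ 3 := by
      have : n ≤ n ^ 3 := Nat.le_self_pow (by norm_num) n
      omega
    have h4 : 3 * (m + 2) * D ≤ 2 * n ^ 3 * D := Nat.mul_le_mul_right _ h3
    nlinarith

/-! ### Butterflies with exactly one member off two consecutive levels. -/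

section Local

variable {n : ℕ}

/-- The butterflies in `F` with `G` as the only member outside the levels `k` and `k + 1`. -/
noncomputable def butterfliesAt (F : Finset (Finset (Fin n))) (k : ℕ) (G : Finset (Fin n)) :
    Finset (Finset (Finset (Fin n))) :=
  (butterflies F).filter fun S => S \ layers n k = {G}

/-- The exceptional member is determined by the butterfly, so the classes are disjoint and local
counts may be added. -/
theorem sum_card_butterfliesAt_le (F O : Finset (Finset (Fin n))) (k : ℕ) :
    ∑ G ∈ O, (butterfliesAt F k G).card ≤ butterflyCount F := by
  rw [butterflyCount_eq_card, ← Finset.card_biUnion]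
  · refine Finset.card_le_card fun S hS => ?_
    obtain ⟨G, -, h⟩ := Finset.mem_biUnion.1 hS
    exact (Finset.mem_filter.1 h).1
  · intro G _ G' _ hne
    refine Finset.disjoint_left.2 fun S h1 h2 => hne ?_
    have h3 := (Finset.mem_filter.1 h1).2
    rw [(Finset.mem_filter.1 h2).2] at h3
    exact (Finset.singleton_injective h3).symm

/-- Butterflies whose exceptional member `G` is below the two levels. -/
theorem mul_choose_le_card_butterfliesAt_of_lt {F : Finset (Finset (Fin n))} {k a c : ℕ}
    {G : Finset (Fin n)} (hG : G ∈ F) (hGk : G.card < k) {𝓑 : Finset (Finset (Fin n))}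
    (h𝓑 : ∀ B ∈ 𝓑, B ∈ F ∧ G ⊆ B ∧ B.card = k ∧ c ≤ (ups B ∩ F).card) (ha : a ≤ 𝓑.card) :
    a * c.choose 2 ≤ (butterfliesAt F k G).card := by
  -- A pair (B, {C, D}) with C, D covers of B gives the butterfly {G, B, C, D}. The part of this
  -- butterfly on level k recovers B and the part on level k+1 recovers {C, D}, so nothing is
  -- counted twice.
  let P := 𝓑.sigma fun B => Finset.powersetCard 2 (ups B ∩ F)
  have hP : a * c.choose 2 ≤ P.card := by
    rw [Finset.card_sigma]
    calc a * c.choose 2 ≤ 𝓑.card * c.choose 2 := Nat.mul_le_mul_right _ ha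
      _ = ∑ _B ∈ 𝓑, c.choose 2 := by rw [Finset.sum_const, smul_eq_mul]
      _ ≤ _ := Finset.sum_le_sum fun B hB => by
        rw [Finset.card_powersetCard]
        exact Nat.choose_le_choose 2 (h𝓑 B hB).2.2.2
  refine hP.trans ?_
  have hsz : ∀ p ∈ P, p.1 ∈ F ∧ G ⊂ p.1 ∧ p.1.card = k ∧ p.2 ⊆ F ∧ p.2.card = 2 ∧
      ∀ C ∈ p.2, p.1 ⊂ C ∧ C.card = k + 1 := by
    intro p hp
    obtain ⟨h1, h2⟩ := Finset.mem_sigma.1 hp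
    obtain ⟨h3, h4⟩ := Finset.mem_powersetCard.1 h2
    obtain ⟨h5, h6, h7, -⟩ := h𝓑 _ h1
    refine ⟨h5, h6.ssubset_of_ne (fun h => by rw [h] at hGk; omega), h7,
      h3.trans Finset.inter_subset_right, h4, fun C hC => ?_⟩
    have h8 := mem_ups.1 (Finset.mem_inter.1 (h3 hC)).1
    exact ⟨h8.1.ssubset_of_ne (fun h => by rw [h] at h8; omega), by omega⟩
  have hfk : ∀ p ∈ P, (insert G (insert p.1 p.2)).filter (fun A => A.card = k) = {p.1} := by
    intro p hp
    obtain ⟨-, -, h3, -, -, h6⟩ := hsz p hp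
    ext A
    simp only [Finset.mem_filter, Finset.mem_insert, Finset.mem_singleton]
    constructor
    · rintro ⟨rfl | rfl | h, h7⟩
      · omega
      · rfl
      · have := (h6 A h).2; omega
    · rintro rfl
      exact ⟨Or.inr (Or.inl rfl), h3⟩
  have hfk1 : ∀ p ∈ P, (insert G (insert p.1 p.2)).filter (fun A => A.card = k + 1) = p.2 := by
    intro p hp
    obtain ⟨-, -, h3, -, -, h6⟩ := hsz p hp
    ext A
    simp only [Finset.mem_filter, Finset.mem_insert]
    constructor
    · rintro ⟨rfl | rfl | h, h7⟩
      · omega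
      · omega
      · exact h
    · intro h
      exact ⟨Or.inr (Or.inr h), (h6 A h).2⟩
  refine Finset.card_le_card_of_injOn (fun p => insert G (insert p.1 p.2)) ?_ ?_
  · intro p hp
    obtain ⟨h1, h2, h3, h4, h5, h6⟩ := hsz p hp
    refine Finset.mem_coe.2 (Finset.mem_filter.2 ⟨mem_butterflies.2 ⟨?_, ?_⟩, ?_⟩)
    · exact Finset.insert_subset hG (Finset.insert_subset h1 h4)
    · obtain ⟨C, D, hCD, hp2⟩ := Finset.card_eq_two.1 h5
      have hC := (h6 C (by rw [hp2]; simp)).1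
      have hD := (h6 D (by rw [hp2]; simp)).1
      exact isCopy_butterfly_iff.2 ⟨G, p.1, C, D, h2.ne, hCD, h2.trans hC, h2.trans hD, hC, hD,
        by change insert G (insert p.1 p.2) = _; rw [hp2]⟩
    · ext A
      simp only [Finset.mem_sdiff, Finset.mem_insert, mem_layers, Finset.mem_singleton]
      constructor
      · rintro ⟨rfl | rfl | h, h7⟩
        · rfl
        · omega
        · have := (h6 A h).2; omega
      · rintro rfl
        exact ⟨Or.inl rfl, by omega⟩
  · intro p hp q hq h
    simp only at h
    have e1 := hfk p hp
    have e2 := hfk1 p hp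
    rw [h, hfk q hq] at e1
    rw [h, hfk1 q hq] at e2
    have e3 : q.1 = p.1 := Finset.singleton_injective e1
    exact Sigma.ext e3.symm (heq_of_eq e2.symm)

/-- Butterflies whose exceptional member `G` is above the two levels. -/
theorem mul_choose_le_card_butterfliesAt_of_gt {F : Finset (Finset (Fin n))} {k a c : ℕ}
    {G : Finset (Fin n)} (hG : G ∈ F) (hGk : k + 1 < G.card) {𝓑 : Finset (Finset (Fin n))}
    (h𝓑 : ∀ B ∈ 𝓑, B ∈ F ∧ B ⊆ G ∧ B.card = k + 1 ∧ c ≤ (downs B ∩ F).card)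
    (ha : a ≤ 𝓑.card) :
    a * c.choose 2 ≤ (butterfliesAt F k G).card := by
  let P := 𝓑.sigma fun B => Finset.powersetCard 2 (downs B ∩ F)
  have hP : a * c.choose 2 ≤ P.card := by
    rw [Finset.card_sigma]
    calc a * c.choose 2 ≤ 𝓑.card * c.choose 2 := Nat.mul_le_mul_right _ ha
      _ = ∑ _B ∈ 𝓑, c.choose 2 := by rw [Finset.sum_const, smul_eq_mul]
      _ ≤ _ := Finset.sum_le_sum fun B hB => by
        rw [Finset.card_powersetCard]
        exact Nat.choose_le_choose 2 (h𝓑 B hB).2.2.2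
  refine hP.trans ?_
  have hsz : ∀ p ∈ P, p.1 ∈ F ∧ p.1 ⊂ G ∧ p.1.card = k + 1 ∧ p.2 ⊆ F ∧ p.2.card = 2 ∧
      ∀ C ∈ p.2, C ⊂ p.1 ∧ C.card = k := by
    intro p hp
    obtain ⟨h1, h2⟩ := Finset.mem_sigma.1 hp
    obtain ⟨h3, h4⟩ := Finset.mem_powersetCard.1 h2
    obtain ⟨h5, h6, h7, -⟩ := h𝓑 _ h1
    refine ⟨h5, h6.ssubset_of_ne (fun h => by rw [h] at h7; omega), h7,
      h3.trans Finset.inter_subset_right, h4, fun C hC => ?_⟩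
    have h8 := mem_downs.1 (Finset.mem_inter.1 (h3 hC)).1
    exact ⟨h8.1.ssubset_of_ne (fun h => by rw [h] at h8; omega), by omega⟩
  have hfk1 : ∀ p ∈ P, (insert G (insert p.1 p.2)).filter (fun A => A.card = k + 1) = {p.1} := by
    intro p hp
    obtain ⟨-, -, h3, -, -, h6⟩ := hsz p hp
    ext A
    simp only [Finset.mem_filter, Finset.mem_insert, Finset.mem_singleton]
    constructor
    · rintro ⟨rfl | rfl | h, h7⟩
      · omega
      · rfl
      · have := (h6 A h).2; omega
    · rintro rfl
      exact ⟨Or.inr (Or.inl rfl), h3⟩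
  have hfk : ∀ p ∈ P, (insert G (insert p.1 p.2)).filter (fun A => A.card = k) = p.2 := by
    intro p hp
    obtain ⟨-, -, h3, -, -, h6⟩ := hsz p hp
    ext A
    simp only [Finset.mem_filter, Finset.mem_insert]
    constructor
    · rintro ⟨rfl | rfl | h, h7⟩
      · omega
      · omega
      · exact h
    · intro h
      exact ⟨Or.inr (Or.inr h), (h6 A h).2⟩
  refine Finset.card_le_card_of_injOn (fun p => insert G (insert p.1 p.2)) ?_ ?_
  · intro p hp
    obtain ⟨h1, h2, h3, h4, h5, h6⟩ := hsz p hp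
    refine Finset.mem_coe.2 (Finset.mem_filter.2 ⟨mem_butterflies.2 ⟨?_, ?_⟩, ?_⟩)
    · exact Finset.insert_subset hG (Finset.insert_subset h1 h4)
    · obtain ⟨C, D, hCD, hp2⟩ := Finset.card_eq_two.1 h5
      have hC := (h6 C (by rw [hp2]; simp)).1
      have hD := (h6 D (by rw [hp2]; simp)).1
      refine isCopy_butterfly_iff.2 ⟨C, D, p.1, G, hCD, h2.ne, hC, hC.trans h2, hD, hD.trans h2,
        ?_⟩
      change insert G (insert p.1 p.2) = _
      rw [hp2]
      ext A
      simp only [Finset.mem_insert, Finset.mem_singleton]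
      tauto
    · ext A
      simp only [Finset.mem_sdiff, Finset.mem_insert, mem_layers, Finset.mem_singleton]
      constructor
      · rintro ⟨rfl | rfl | h, h7⟩
        · rfl
        · omega
        · have := (h6 A h).2; omega
      · rintro rfl
        exact ⟨Or.inl rfl, by omega⟩
  · intro p hp q hq h
    simp only at h
    have e1 := hfk1 p hp
    have e2 := hfk p hp
    rw [h, hfk1 q hq] at e1
    rw [h, hfk q hq] at e2
    have e3 : q.1 = p.1 := Finset.singleton_injective e1
    exact Sigma.ext e3.symm (heq_of_eq e2.symm)

theorem card_downs_inter_le (A : Finset (Fin n)) (Z : Finset (Finset (Fin n))) :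
    (downs A ∩ Z).card ≤ cubeDegree Z A := by
  have : downs A ∩ Z ⊆ (Finset.univ.filter fun x => symmDiff A {x} ∈ Z).image
      fun x => symmDiff A {x} := by
    intro B hB
    obtain ⟨h1, h2⟩ := Finset.mem_inter.1 hB
    obtain ⟨x, hx, rfl⟩ := Finset.mem_image.1 h1
    have he : symmDiff A {x} = A.erase x := by
      ext y
      rw [mem_symmDiff_singleton, Finset.mem_erase]
      by_cases hy : y = x
      · subst hy; tauto
      · tauto
    refine Finset.mem_image.2 ⟨x, ?_, he⟩
    rw [Finset.mem_filter, he]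
    exact ⟨Finset.mem_univ _, h2⟩
  exact (Finset.card_le_card this).trans Finset.card_image_le

/-- A set outside a percolation-closed family containing all the missing sets lies in many
butterflies. -/
theorem mul_choose_le_card_butterfliesAt_of_percolation {F Z : Finset (Finset (Fin n))}
    {k m h : ℕ} (hmk : m ≤ k + 1) (hmn : m + k ≤ n) (hhm : h ≤ m) (hRZ : layers n k \ F ⊆ Z)
    (hZ : ∀ v ∉ Z, cubeDegree Z v < h) {G : Finset (Fin n)} (hG : G ∈ F)
    (hGk : G ∉ layers n k) (hGZ : G ∉ Z) :
    (m + 2 - h) * (m + 1 - h).choose 2 ≤ (butterfliesAt F k G).card := by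
  have hmemF : ∀ A : Finset (Fin n), A ∉ Z → (A.card = k ∨ A.card = k + 1) → A ∈ F := by
    intro A hA hk
    by_contra hcon
    exact hA (hRZ (Finset.mem_sdiff.2 ⟨mem_layers.2 hk, hcon⟩))
  -- The extra 1 records that the degree into `Z` is strictly below `h`.
  have hups : ∀ A ∉ Z, n + 1 - A.card ≤ (ups A \ Z).card + h := by
    intro A hA
    have h1 := hZ A hA
    have h2 := card_ups_inter_le A Z
    have h3 := Finset.card_inter_add_card_sdiff (ups A) Z
    rw [card_ups] at h3
    omega
  have hdowns : ∀ A ∉ Z, A.card + 1 ≤ (downs A \ Z).card + h := by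
    intro A hA
    have h1 := hZ A hA
    have h2 := card_downs_inter_le A Z
    have h3 := Finset.card_inter_add_card_sdiff (downs A) Z
    rw [card_downs] at h3
    omega
  rw [mem_layers, not_or] at hGk
  rcases lt_or_gt_of_ne hGk.1 with hlt | hgt
  · obtain ⟨G', hGG', hG'k, hG'Z⟩ : ∃ G' : Finset (Fin n), G ⊆ G' ∧ G'.card + 1 = k ∧ G' ∉ Z := by
      -- `G` may lie far below the two levels. Fewer than h ≤ m covers of a set outside `Z` lie in
      -- `Z`, so one can always climb without entering `Z`.
      have climb : ∀ d : ℕ, ∀ A : Finset (Fin n), A ∉ Z → A.card + d + 1 = k →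
          ∃ A' : Finset (Fin n), A ⊆ A' ∧ A'.card + 1 = k ∧ A' ∉ Z := by
        intro d
        induction d with
        | zero => intro A hA hc; exact ⟨A, subset_rfl, by omega, hA⟩
        | succ d ih =>
          intro A hA hc
          have h1 := hups A hA
          obtain ⟨B, hB⟩ := Finset.card_pos.1 (show 0 < (ups A \ Z).card by omega)
          obtain ⟨hB1, hB2⟩ := Finset.mem_sdiff.1 hB
          obtain ⟨hAB, hBc⟩ := mem_ups.1 hB1
          obtain ⟨A', h2, h3, h4⟩ := ih B hB2 (by omega)
          exact ⟨A', hAB.trans h2, h3, h4⟩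
      exact climb (k - 1 - G.card) G hGZ (by omega)
    refine mul_choose_le_card_butterfliesAt_of_lt hG hlt (𝓑 := ups G' \ Z) ?_ ?_
    · intro B hB
      obtain ⟨hB1, hB2⟩ := Finset.mem_sdiff.1 hB
      obtain ⟨h1, h2⟩ := mem_ups.1 hB1
      refine ⟨hmemF B hB2 (Or.inl (by omega)), hGG'.trans h1, by omega, ?_⟩
      have h3 := hups B hB2
      have h4 : (ups B \ Z).card ≤ (ups B ∩ F).card := Finset.card_le_card fun C hC => by
        obtain ⟨hC1, hC2⟩ := Finset.mem_sdiff.1 hC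
        have := (mem_ups.1 hC1).2
        exact Finset.mem_inter.2 ⟨hC1, hmemF C hC2 (Or.inr (by omega))⟩
      omega
    · have := hups G' hG'Z
      omega
  · obtain ⟨G', hGG', hG'k, hG'Z⟩ : ∃ G' : Finset (Fin n), G' ⊆ G ∧ G'.card = k + 2 ∧ G' ∉ Z := by
      have climb : ∀ d : ℕ, ∀ A : Finset (Fin n), A ∉ Z → A.card = k + 2 + d →
          ∃ A' : Finset (Fin n), A' ⊆ A ∧ A'.card = k + 2 ∧ A' ∉ Z := by
        intro d
        induction d with
        | zero => intro A hA hc; exact ⟨A, subset_rfl, by omega, hA⟩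
        | succ d ih =>
          intro A hA hc
          have h1 := hdowns A hA
          obtain ⟨B, hB⟩ := Finset.card_pos.1 (show 0 < (downs A \ Z).card by omega)
          obtain ⟨hB1, hB2⟩ := Finset.mem_sdiff.1 hB
          obtain ⟨hAB, hBc⟩ := mem_downs.1 hB1
          obtain ⟨A', h2, h3, h4⟩ := ih B hB2 (by omega)
          exact ⟨A', h2.trans hAB, h3, h4⟩
      exact climb (G.card - (k + 2)) G hGZ (by omega)
    refine mul_choose_le_card_butterfliesAt_of_gt hG (by omega) (𝓑 := downs G' \ Z) ?_ ?_
    · intro B hB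
      obtain ⟨hB1, hB2⟩ := Finset.mem_sdiff.1 hB
      obtain ⟨h1, h2⟩ := mem_downs.1 hB1
      refine ⟨hmemF B hB2 (Or.inr (by omega)), h1.trans hGG', by omega, ?_⟩
      have h3 := hdowns B hB2
      have h4 : (downs B \ Z).card ≤ (downs B ∩ F).card := Finset.card_le_card fun C hC => by
        obtain ⟨hC1, hC2⟩ := Finset.mem_sdiff.1 hC
        have := (mem_downs.1 hC1).2
        exact Finset.mem_inter.2 ⟨hC1, hmemF C hC2 (Or.inl (by omega))⟩
      omega
    · have := hdowns G' hG'Z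
      omega

/-- Each missing set spoils the butterflies through at most two middle sets. -/
theorem mul_choose_le_card_butterfliesAt {F : Finset (Finset (Fin n))}
    {k m : ℕ} (hmk : m ≤ k + 1) (hmn : m + k ≤ n) {G : Finset (Fin n)} (hG : G ∈ F)
    (hGk : G ∉ layers n k) :
    (m + 1 - 2 * (layers n k \ F).card) * m.choose 2 ≤ (butterfliesAt F k G).card := by
  set R := layers n k \ F with hR
  have hmemF : ∀ A : Finset (Fin n), A ∉ R → (A.card = k ∨ A.card = k + 1) → A ∈ F := by
    intro A hA hk
    by_contra hcon
    exact hA (Finset.mem_sdiff.2 ⟨mem_layers.2 hk, hcon⟩)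
  have hRk : ∀ A ∈ R, A.card = k ∨ A.card = k + 1 := fun A hA =>
    mem_layers.1 (Finset.mem_sdiff.1 hA).1
  rw [mem_layers, not_or] at hGk
  rcases lt_or_gt_of_ne hGk.1 with hlt | hgt
  · obtain ⟨G', hGG', hG'k⟩ : ∃ G' : Finset (Fin n), G ⊆ G' ∧ G'.card = k - 1 :=
      Finset.exists_superset_card_eq (by omega) (by rw [Fintype.card_fin]; omega)
    -- `K` collects the spoiled choices of `B`. A missing `X` containing `G'` has at most two
    -- elements more than `G'`, hence contains at most two covers of `G'`.
    let K := R.biUnion fun X => (ups G').filter fun B => B ⊆ X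
    have hK : K.card ≤ R.card * 2 := by
      refine Finset.card_biUnion_le_card_mul _ _ _ fun X hX => ?_
      by_cases hGX : G' ⊆ X
      · have hsub : ((ups G').filter fun B => B ⊆ X) ⊆ (X \ G').image fun x => insert x G' := by
          intro B hB
          obtain ⟨h1, h2⟩ := Finset.mem_filter.1 hB
          obtain ⟨x, hx, rfl⟩ := Finset.mem_image.1 h1
          exact Finset.mem_image.2 ⟨x, Finset.mem_sdiff.2
            ⟨h2 (Finset.mem_insert_self _ _), Finset.mem_compl.1 hx⟩, rfl⟩
        refine (Finset.card_le_card hsub).trans (Finset.card_image_le.trans ?_)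
        rw [Finset.card_sdiff_of_subset hGX]
        have := hRk X hX
        omega
      · rw [Finset.filter_eq_empty_iff.2]
        · simp
        · intro B hB hBX
          exact hGX ((mem_ups.1 hB).1.trans hBX)
    refine mul_choose_le_card_butterfliesAt_of_lt hG hlt (𝓑 := ups G' \ K) ?_ ?_
    · intro B hB
      obtain ⟨hB1, hB2⟩ := Finset.mem_sdiff.1 hB
      obtain ⟨h1, h2⟩ := mem_ups.1 hB1
      have hno : ∀ X ∈ R, ¬ B ⊆ X := fun X hX hBX =>
        hB2 (Finset.mem_biUnion.2 ⟨X, hX, Finset.mem_filter.2 ⟨hB1, hBX⟩⟩)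
      refine ⟨hmemF B (fun h => hno B h subset_rfl) (Or.inl (by omega)), hGG'.trans h1,
        by omega, ?_⟩
      rw [Finset.inter_eq_left.2, card_ups]
      · omega
      · intro C hC
        obtain ⟨h3, h4⟩ := mem_ups.1 hC
        exact hmemF C (fun h => hno C h h3) (Or.inr (by omega))
    · have := Finset.le_card_sdiff K (ups G')
      rw [card_ups] at this
      omega
  · obtain ⟨G', hGG', hG'k⟩ : ∃ G' : Finset (Fin n), G' ⊆ G ∧ G'.card = k + 2 :=
      Finset.exists_subset_card_eq (by omega)
    let K := R.biUnion fun X => (downs G').filter fun B => X ⊆ B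
    have hK : K.card ≤ R.card * 2 := by
      refine Finset.card_biUnion_le_card_mul _ _ _ fun X hX => ?_
      by_cases hGX : X ⊆ G'
      · have hsub : ((downs G').filter fun B => X ⊆ B) ⊆ (G' \ X).image fun x => G'.erase x := by
          intro B hB
          obtain ⟨h1, h2⟩ := Finset.mem_filter.1 hB
          obtain ⟨x, hx, rfl⟩ := Finset.mem_image.1 h1
          exact Finset.mem_image.2 ⟨x, Finset.mem_sdiff.2
            ⟨hx, fun h => Finset.notMem_erase x G' (h2 h)⟩, rfl⟩
        refine (Finset.card_le_card hsub).trans (Finset.card_image_le.trans ?_)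
        rw [Finset.card_sdiff_of_subset hGX]
        have := hRk X hX
        omega
      · rw [Finset.filter_eq_empty_iff.2]
        · simp
        · intro B hB hBX
          exact hGX (hBX.trans (mem_downs.1 hB).1)
    refine mul_choose_le_card_butterfliesAt_of_gt hG (by omega) (𝓑 := downs G' \ K) ?_ ?_
    · intro B hB
      obtain ⟨hB1, hB2⟩ := Finset.mem_sdiff.1 hB
      obtain ⟨h1, h2⟩ := mem_downs.1 hB1
      have hno : ∀ X ∈ R, ¬ X ⊆ B := fun X hX hBX =>
        hB2 (Finset.mem_biUnion.2 ⟨X, hX, Finset.mem_filter.2 ⟨hB1, hBX⟩⟩)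
      refine ⟨hmemF B (fun h => hno B h subset_rfl) (Or.inr (by omega)), h1.trans hGG',
        by omega, ?_⟩
      rw [Finset.inter_eq_left.2, card_downs]
      · omega
      · intro C hC
        obtain ⟨h3, h4⟩ := mem_downs.1 hC
        exact hmemF C (fun h => hno C h h3) (Or.inl (by omega))
    · have := Finset.le_card_sdiff K (downs G')
      rw [card_downs] at this
      omega

end Local

/-! ### The lower bounds, from approximate to exact. -/

section Lower

variable {n : ℕ}

theorem two_mul_choose_two (m : ℕ) : 2 * m.choose 2 = m * (m - 1) := by
  rw [Nat.choose_two_right, Nat.mul_div_cancel' (Nat.even_mul_pred_self m).two_dvd]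

theorem two_mul_f (n : ℕ) :
    2 * f n = ((n + 1) / 2 + 1) * ((n + 1) / 2 * ((n + 1) / 2 - 1)) := by
  rw [f, ← two_mul_choose_two]; ring

theorem eight_mul_f_le {n : ℕ} (hn : 4 ≤ n) : 8 * f n ≤ n ^ 3 := by
  have h1 := two_mul_f n
  obtain ⟨m, hm⟩ : ∃ m, (n + 1) / 2 = m + 1 := ⟨(n + 1) / 2 - 1, by omega⟩
  rw [hm, Nat.add_sub_cancel] at h1
  obtain ⟨d, rfl⟩ : ∃ d, n = 2 * m + 1 + d := ⟨n - (2 * m + 1), by omega⟩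
  have hm1 : 1 ≤ m := by omega
  have h2 : 4 * ((m + 1 + 1) * ((m + 1) * m)) ≤ (2 * m + 1) ^ 3 := by
    nlinarith [mul_le_mul hm1 (le_refl m) (by omega) (by omega)]
  calc 8 * f (2 * m + 1 + d) = 4 * ((m + 1 + 1) * ((m + 1) * m)) := by linarith
    _ ≤ (2 * m + 1) ^ 3 := h2
    _ ≤ _ := Nat.pow_le_pow_left (by omega) 3

/-- A family with more than `Σ(n,2)` sets and few butterflies almost contains two consecutive
middle levels. -/
theorem exists_layers_of_butterflyCount_lt {E : ℕ} (hn : 22 ≤ n) {F : Finset (Finset (Fin n))}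
    (hF : F.card = sigmaTwo n + E) (hb : butterflyCount F < E * f n)
    (hE : n ^ 3 * (E * f n) ≤ 2 ^ n) :
    ∃ k, (n + 1) / 2 ≤ k + 1 ∧ (n + 1) / 2 + k ≤ n ∧ n.choose k + n.choose (k + 1) = sigmaTwo n ∧
      3 * (layers n k \ F).card ≤ n ^ 3 * (E * f n) := by
  have hEpos : 0 < E := by
    rcases Nat.eq_zero_or_pos E with h | h
    · rw [h, zero_mul] at hb; omega
    · exact h
  obtain ⟨G, hGF, hG, hcard⟩ := exists_butterflyFree_subset F
  -- Removing ∅ and `univ` costs at most two sets. The strict inequality in `hb` and E ≥ 1 pay for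
  -- them, so the deficit is still at most E f(n).
  set H := (G.erase ∅).erase Finset.univ with hH
  have hHG : H ⊆ G := (Finset.erase_subset _ _).trans (Finset.erase_subset _ _)
  have hHfree : ButterflyFree H := fun A hA B hB C hC D hD =>
    hG A (hHG hA) B (hHG hB) C (hHG hC) D (hHG hD)
  have hHcard : G.card ≤ H.card + 2 := by
    have h1 := Finset.pred_card_le_card_erase (s := G) (a := ∅)
    have h2 := Finset.pred_card_le_card_erase (s := G.erase ∅) (a := Finset.univ)
    rw [← hH] at h2
    omega
  obtain ⟨k, h1, h2, h3, h4⟩ := hHfree.stability (D := E * f n) hn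
    (fun h => Finset.notMem_erase ∅ G (Finset.erase_subset _ _ h))
    (Finset.notMem_erase _ _) (by omega) hE
  refine ⟨k, h1, h2, h3, le_trans ?_ h4⟩
  exact Nat.mul_le_mul_left _ (Finset.card_le_card
    (Finset.sdiff_subset_sdiff subset_rfl (hHG.trans hGF)))

/-- Each missing set is compensated by an additional member off the levels; this surplus outweighs
what the percolation closure absorbs. -/
theorem card_sdiff_layers {E k : ℕ} {F : Finset (Finset (Fin n))}
    (hF : F.card = sigmaTwo n + E) (hk : n.choose k + n.choose (k + 1) = sigmaTwo n) :
    (F \ layers n k).card = (layers n k \ F).card + E := by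
  have h1 := Finset.card_inter_add_card_sdiff (layers n k) F
  have h2 := Finset.card_inter_add_card_sdiff F (layers n k)
  rw [card_layers, hk] at h1
  rw [Finset.inter_comm] at h2
  omega

/-- If few sets of two middle levels are missing, then most of the sets outside these levels lie
in many butterflies. -/
theorem exists_butterflyCount_ge {E k h l : ℕ} {F : Finset (Finset (Fin n))}
    (hF : F.card = sigmaTwo n + E) (hk : n.choose k + n.choose (k + 1) = sigmaTwo n)
    (hk1 : (n + 1) / 2 ≤ k + 1) (hk2 : (n + 1) / 2 + k ≤ n) (hh : h ≤ (n + 1) / 2) (hl : l < h)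
    (hR : 2 * (layers n k \ F).card ≤ 2 ^ l) :
    ∃ z, 2 * h * z ≤ l * ((layers n k \ F).card + z) ∧
      ((layers n k \ F).card + E) * (((n + 1) / 2 + 2 - h) * ((n + 1) / 2 + 1 - h).choose 2)
        ≤ butterflyCount F + z * (((n + 1) / 2 + 2 - h) * ((n + 1) / 2 + 1 - h).choose 2) := by
  obtain ⟨Z, hRZ, hZ, hz⟩ := exists_percolation_closure (layers n k \ F) hl hR
  refine ⟨_, hz, ?_⟩
  rw [← card_sdiff_layers hF hk]
  set g := ((n + 1) / 2 + 2 - h) * ((n + 1) / 2 + 1 - h).choose 2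
  set O := F \ layers n k with hO
  have h1 : (O \ Z).card * g ≤ butterflyCount F := by
    refine le_trans ?_ (sum_card_butterfliesAt_le F (O \ Z) k)
    rw [← smul_eq_mul, ← Finset.sum_const]
    refine Finset.sum_le_sum fun G hG => ?_
    obtain ⟨hG1, hG2⟩ := Finset.mem_sdiff.1 hG
    obtain ⟨hG3, hG4⟩ := Finset.mem_sdiff.1 hG1
    exact mul_choose_le_card_butterfliesAt_of_percolation hk1 hk2 hh hRZ hZ hG3 hG4 hG2
  have h2 : O.card ≤ (O \ Z).card + (Z \ (layers n k \ F)).card := by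
    have h3 : (O ∩ Z).card ≤ (Z \ (layers n k \ F)).card :=
      Finset.card_le_card fun G hG => by
        obtain ⟨hG1, hG2⟩ := Finset.mem_inter.1 hG
        exact Finset.mem_sdiff.2 ⟨hG2, fun h4 =>
          (Finset.mem_sdiff.1 h4).2 (Finset.mem_sdiff.1 hG1).1⟩
    have := Finset.card_inter_add_card_sdiff O Z
    omega
  calc O.card * g ≤ ((O \ Z).card + (Z \ (layers n k \ F)).card) * g := Nat.mul_le_mul_right _ h2
    _ ≤ _ := by rw [add_mul]; exact Nat.add_le_add_right h1 _

/-- The exact bound, for families differing very little from two middle levels. -/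
theorem mul_f_le_butterflyCount_of_card_le {E k : ℕ} {F : Finset (Finset (Fin n))}
    (hF : F.card = sigmaTwo n + E) (hk : n.choose k + n.choose (k + 1) = sigmaTwo n)
    (hk1 : (n + 1) / 2 ≤ k + 1) (hk2 : (n + 1) / 2 + k ≤ n)
    (hr : 2 * ((layers n k \ F).card + E) ≤ (n + 1) / 2 + 1) :
    E * f n ≤ butterflyCount F := by
  refine le_trans ?_ (sum_card_butterfliesAt_le F (F \ layers n k) k)
  have h1 : (F \ layers n k).card *
      (((n + 1) / 2 + 1 - 2 * (layers n k \ F).card) * ((n + 1) / 2).choose 2)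
      ≤ ∑ G ∈ F \ layers n k, (butterfliesAt F k G).card := by
    rw [← smul_eq_mul, ← Finset.sum_const]
    refine Finset.sum_le_sum fun G hG => ?_
    obtain ⟨hG1, hG2⟩ := Finset.mem_sdiff.1 hG
    exact mul_choose_le_card_butterfliesAt hk1 hk2 hG1 hG2
  refine le_trans ?_ h1
  rw [card_sdiff_layers hF hk, f, ← mul_assoc, ← mul_assoc]
  refine Nat.mul_le_mul_right _ ?_
  set r := (layers n k \ F).card
  -- With M = ⌈n/2⌉ + 1, the remaining claim (r+E)(M-2r) ≥ E·M is equivalent to r(M - 2(r+E)) ≥ 0.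
  obtain ⟨s, hs⟩ : ∃ s, (n + 1) / 2 + 1 = 2 * (r + E) + s := ⟨_, (Nat.add_sub_of_le hr).symm⟩
  rw [hs, show 2 * (r + E) + s - 2 * r = 2 * E + s by omega]
  nlinarith

/-- Comparing `f` with the number of butterflies guaranteed at threshold `h`. -/
theorem pow_mul_f_le {p q h : ℕ} (hqp : q ≤ p) (hh : q * ((n + 1) / 2) + p * h ≤ p * ((n + 1) / 2))
    (hp : 0 < p) :
    q ^ 3 * f n ≤ p ^ 3 * (((n + 1) / 2 + 2 - h) * ((n + 1) / 2 + 1 - h).choose 2) := by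
  set m := (n + 1) / 2 with hm
  have hhm : h ≤ m := by
    refine Nat.le_of_mul_le_mul_left ?_ hp
    omega
  obtain ⟨d, hd⟩ := Nat.exists_eq_add_of_le hhm
  have e1 : m + 2 - h = d + 2 := by omega
  have e2 : m + 1 - h = d + 1 := by omega
  have hqd : q * m ≤ p * d := by
    have : p * m = p * h + p * d := by rw [hd, mul_add]
    omega
  have h2f := two_mul_f n
  rw [← hm] at h2f
  have h2c := two_mul_choose_two (d + 1)
  rw [Nat.add_sub_cancel] at h2c
  rw [e1, e2]
  have i1 : q * (m + 1) ≤ p * (d + 2) := by nlinarith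
  have i2 : q * m ≤ p * (d + 1) := by nlinarith
  have i3 : q * (m - 1) ≤ p * d := (Nat.mul_le_mul_left _ (Nat.sub_le _ _)).trans hqd
  have key : (q * (m + 1)) * ((q * m) * (q * (m - 1))) ≤ (p * (d + 2)) * ((p * (d + 1)) * (p * d)) :=
    Nat.mul_le_mul i1 (Nat.mul_le_mul i2 i3)
  have l1 : 2 * (q ^ 3 * f n) = (q * (m + 1)) * ((q * m) * (q * (m - 1))) := by
    calc 2 * (q ^ 3 * f n) = q ^ 3 * (2 * f n) := by ring
      _ = _ := by rw [h2f]; ring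
  have l2 : 2 * (p ^ 3 * ((d + 2) * (d + 1).choose 2))
      = (p * (d + 2)) * ((p * (d + 1)) * (p * d)) := by
    calc 2 * (p ^ 3 * ((d + 2) * (d + 1).choose 2))
        = p ^ 3 * ((d + 2) * (2 * (d + 1).choose 2)) := by ring
      _ = _ := by rw [h2c]; ring
  omega

/-- Steps of five: the exponent grows by exactly 2, while ((j+5)/j)^7 ≤ (21/20)^7 < 4 for j ≥ 100.
The constant 1200 covers the five base cases and matches 2r ≤ n^7 / 1200 in the next proof. -/
theorem pow_seven_le (n : ℕ) (hn : 100 ≤ n) : n ^ 7 ≤ 1200 * 2 ^ (2 * n / 5) := by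
  induction n using Nat.strong_induction_on with
  | _ n ih =>
  rcases Nat.lt_or_ge n 105 with h | h
  · interval_cases n <;> norm_num
  · obtain ⟨j, rfl⟩ : ∃ j, n = j + 5 := ⟨n - 5, by omega⟩
    have h1 := ih j (by omega) (by omega)
    have h2 : 2 * (j + 5) / 5 = 2 * j / 5 + 2 := by omega
    rw [h2, pow_add]
    have h3 : (20 * (j + 5)) ^ 7 ≤ (21 * j) ^ 7 := Nat.pow_le_pow_left (by omega) 7
    rw [mul_pow, mul_pow] at h3
    norm_num at h3 ⊢
    omega

theorem mul_le_two_pow (s : ℕ) (hs : 16 ≤ s) : 200 * (6 * s + 5) ≤ 2 ^ s := by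
  induction s, hs using Nat.le_induction with
  | base => norm_num
  | succ s _ ih => rw [pow_succ]; omega

/-- The exact lower bound of the number of butterflies for a small excess. -/
theorem mul_f_le_butterflyCount {E : ℕ} (hE : 100 * E ≤ n) {F : Finset (Finset (Fin n))}
    (hF : F.card = sigmaTwo n + E) : E * f n ≤ butterflyCount F := by
  by_contra hcon
  push Not at hcon
  have hEpos : 0 < E := by
    rcases Nat.eq_zero_or_pos E with h | h
    · rw [h, zero_mul] at hcon; omega
    · exact h
  have hn : 100 ≤ n := by omega
  have hsmall : 800 * (n ^ 3 * (E * f n)) ≤ n ^ 7 := by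
    have h1 := eight_mul_f_le (n := n) (by omega)
    calc 800 * (n ^ 3 * (E * f n)) = n ^ 3 * ((100 * E) * (8 * f n)) := by ring
      _ ≤ n ^ 3 * (n * n ^ 3) := Nat.mul_le_mul_left _ (Nat.mul_le_mul hE h1)
      _ = n ^ 7 := by ring
  have h7 := pow_seven_le n hn
  obtain ⟨k, hk1, hk2, hk, hr⟩ := exists_layers_of_butterflyCount_lt (by omega) hF hcon (by
    calc n ^ 3 * (E * f n) ≤ 2 ^ (2 * n / 5 + 1) := by rw [pow_succ 2]; omega
      _ ≤ 2 ^ n := Nat.pow_le_pow_right (by norm_num) (by omega))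
  set r := (layers n k \ F).card with hrdef
  have hr7 : 800 * (3 * r) ≤ n ^ 7 := (Nat.mul_le_mul_left _ hr).trans hsmall
  -- Stability bounds 2r only by about 2^(2n/5), so l = 2n/5 and h must lie between l and n/2. Here
  -- l ≤ (18/19)h gives z ≤ 9r/10, and h ≤ (9/10)⌈n/2⌉ gives g ≥ f/1000. The product of the losses
  -- is 10 · 1000.
  have step1 : r + E ≤ 10000 * E := by
    obtain ⟨z, hz, hb⟩ := exists_butterflyCount_ge (h := 9 * n / 20) (l := 2 * n / 5) hF hk hk1 hk2
      (by omega) (by omega) (by omega)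
    rw [← hrdef] at hz hb
    have hg := pow_mul_f_le (n := n) (p := 10) (q := 1) (h := 9 * n / 20) (by norm_num)
      (by omega) (by norm_num)
    set g := ((n + 1) / 2 + 2 - 9 * n / 20) * ((n + 1) / 2 + 1 - 9 * n / 20).choose 2
    have hgpos : 0 < g :=
      Nat.mul_pos (by omega) (Nat.choose_pos (by omega))
    have hz' : 10 * z ≤ 9 * r := by
      set h := 9 * n / 20
      set l := 2 * n / 5
      have hlh : 19 * l ≤ 18 * h := by omega
      have hhpos : 0 < h := by omega
      by_contra hlt
      push Not at hlt
      nlinarith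
    refine Nat.le_of_mul_le_mul_right ?_ hgpos
    nlinarith
  -- Now 2r ≤ 20000E ≤ 200n ≤ 2^(n/6), which permits h = n/4: z ≤ 3r/5 and g ≥ f/8, so the losses
  -- multiply to (5/2) · 8.
  have step2 : r + E ≤ 20 * E := by
    obtain ⟨z, hz, hb⟩ := exists_butterflyCount_ge (h := n / 4) (l := n / 6) hF hk hk1 hk2
      (by omega) (by omega) (by
        have := mul_le_two_pow (n / 6) (by omega)
        omega)
    rw [← hrdef] at hz hb
    have hg := pow_mul_f_le (n := n) (p := 2) (q := 1) (h := n / 4) (by norm_num)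
      (by omega) (by norm_num)
    set g := ((n + 1) / 2 + 2 - n / 4) * ((n + 1) / 2 + 1 - n / 4).choose 2
    have hgpos : 0 < g :=
      Nat.mul_pos (by omega) (Nat.choose_pos (by omega))
    have hz' : 5 * z ≤ 3 * r := by
      set h := n / 4
      set l := n / 6
      have hlh : 8 * l ≤ 6 * h := by omega
      have hhpos : 0 < h := by omega
      by_contra hlt
      push Not at hlt
      nlinarith
    refine Nat.le_of_mul_le_mul_right ?_ hgpos
    nlinarith
  have := mul_f_le_butterflyCount_of_card_le hF hk hk1 hk2 (by omega)
  omega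

end Lower

/-! ### Families attaining the bound. -/

section Construction

variable {n : ℕ}

theorem card_filter_val_Ico {a b : ℕ} (hb : b ≤ n) :
    ((Finset.univ : Finset (Fin n)).filter fun x => a ≤ x.val ∧ x.val < b).card = b - a := by
  rw [← Nat.card_Ico, ← Finset.card_map Fin.valEmbedding]
  congr 1
  ext y
  simp only [Finset.mem_map, Finset.mem_filter, Finset.mem_univ, true_and, Fin.valEmbedding_apply,
    Finset.mem_Ico]
  constructor
  · rintro ⟨x, hx, rfl⟩; exact hx
  · intro hy; exact ⟨⟨y, by omega⟩, hy, rfl⟩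

/-- There are many sets of size `k - 1` with pairwise unions of size greater than `k`. -/
theorem exists_separated_family {k E : ℕ} (hk : 3 ≤ k) (hE : 2 * E + k ≤ n + 3) :
    ∃ 𝒢 : Finset (Finset (Fin n)), 𝒢.card = E ∧ (∀ G ∈ 𝒢, G.card + 1 = k) ∧
      ∀ G ∈ 𝒢, ∀ G' ∈ 𝒢, G ≠ G' → k < (G ∪ G').card := by
  -- Windows of length k-1 shifted by steps of 2: the last two elements of a later window lie beyond
  -- any earlier one, so a union has at least k+1 elements.
  let w : ℕ → Finset (Fin n) := fun i =>
    Finset.univ.filter fun x => 2 * i ≤ x.val ∧ x.val < 2 * i + k - 1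
  have hw : ∀ i < E, (w i).card + 1 = k := by
    intro i hi
    rw [card_filter_val_Ico (by omega)]
    omega
  have hlt : ∀ i j, i < j → j < E → k < (w i ∪ w j).card := by
    intro i j hij hj
    let v : Finset (Fin n) :=
      Finset.univ.filter fun x => 2 * j + k - 3 ≤ x.val ∧ x.val < 2 * j + k - 1
    have hv : v.card = 2 := by
      rw [card_filter_val_Ico (by omega)]; omega
    have hdis : Disjoint (w i) v := by
      rw [Finset.disjoint_filter]; intro x _ h1 h2; omega
    have hsub : v ⊆ w j := by
      intro x hx
      have := (Finset.mem_filter.1 hx).2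
      exact Finset.mem_filter.2 ⟨Finset.mem_univ _, by omega⟩
    have h1 := Finset.card_le_card (Finset.union_subset_union (subset_refl (w i)) hsub)
    rw [Finset.card_union_of_disjoint hdis, hv] at h1
    have := hw i (by omega)
    omega
  have hlt' : ∀ i < E, ∀ j < E, i ≠ j → k < (w i ∪ w j).card := by
    intro i hi j hj hne
    rcases lt_or_gt_of_ne hne with h | h
    · exact hlt i j h hj
    · rw [Finset.union_comm]; exact hlt j i h hi
  refine ⟨(Finset.range E).image w, ?_, ?_, ?_⟩
  · rw [Finset.card_image_of_injOn, Finset.card_range]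
    intro i hi j hj h
    have hi' : i < E := by simpa using hi
    have hj' : j < E := by simpa using hj
    by_contra hne
    have h1 := hlt' i hi' j hj' hne
    change w i = w j at h
    rw [← h, Finset.union_self] at h1
    have := hw i hi'
    omega
  · intro G hG
    obtain ⟨i, hi, rfl⟩ := Finset.mem_image.1 hG
    exact hw i (Finset.mem_range.1 hi)
  · intro G hG G' hG' hne
    obtain ⟨i, hi, rfl⟩ := Finset.mem_image.1 hG
    obtain ⟨j, hj, rfl⟩ := Finset.mem_image.1 hG'
    exact hlt' i (Finset.mem_range.1 hi) j (Finset.mem_range.1 hj) fun h => hne (by rw [h])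

/-- Adding to two consecutive levels a separated family from the level below creates only the
obvious butterflies. -/
theorem butterflyCount_layers_union_le {k : ℕ} {𝒢 : Finset (Finset (Fin n))}
    (h𝒢 : ∀ G ∈ 𝒢, G.card + 1 = k)
    (hsep : ∀ G ∈ 𝒢, ∀ G' ∈ 𝒢, G ≠ G' → k < (G ∪ G').card) :
    butterflyCount (layers n k ∪ 𝒢) ≤ 𝒢.card * ((n - k + 1) * (n - k).choose 2) := by
  rw [butterflyCount_eq_card]
  let P : Finset (Fin n) → Finset (Finset (Finset (Fin n))) := fun G =>
    ((ups G).sigma fun B => Finset.powersetCard 2 (ups B)).image fun p => insert G (insert p.1 p.2)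
  have hP : ∀ G ∈ 𝒢, (P G).card ≤ (n - k + 1) * (n - k).choose 2 := by
    intro G hG
    refine Finset.card_image_le.trans ?_
    have hGn : G.card ≤ n := by simpa using G.card_le_univ
    rw [Finset.card_sigma]
    calc _ = ∑ _B ∈ ups G, (n - k).choose 2 := by
          refine Finset.sum_congr rfl fun B hB => ?_
          rw [Finset.card_powersetCard, card_ups, (mem_ups.1 hB).2, h𝒢 G hG]
      _ = (n - G.card) * (n - k).choose 2 := by rw [Finset.sum_const, card_ups, smul_eq_mul]
      _ ≤ _ := Nat.mul_le_mul_right _ (by have := h𝒢 G hG; omega)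
  refine (Finset.card_le_card (t := 𝒢.biUnion P) ?_).trans
    (Finset.card_biUnion_le_card_mul _ _ _ hP)
  intro S hS
  obtain ⟨hSF, hcopy⟩ := mem_butterflies.1 hS
  obtain ⟨A, B, C, D, hAB, hCD, hAC, hAD, hBC, hBD, rfl⟩ := isCopy_butterfly_iff.1 hcopy
  have hmem : ∀ X ∈ ({A, B, C, D} : Finset (Finset (Fin n))),
      (X ∈ 𝒢 ∧ X.card + 1 = k) ∨ X.card = k ∨ X.card = k + 1 := by
    intro X hX
    rcases Finset.mem_union.1 (hSF hX) with h | h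
    · exact Or.inr (mem_layers.1 h)
    · exact Or.inl ⟨h, h𝒢 X h⟩
  have mA := hmem A (by simp)
  have mB := hmem B (by simp)
  have mC := hmem C (by simp)
  have mD := hmem D (by simp)
  have cAC := Finset.card_lt_card hAC
  have cAD := Finset.card_lt_card hAD
  have cBC := Finset.card_lt_card hBC
  have cBD := Finset.card_lt_card hBD
  -- Everything follows from A ∪ B ⊆ C ∩ D and |C ∩ D| ≤ k. Separation excludes two lower members
  -- from `𝒢`, and two distinct sets of size k have too large a union. So one lower member is in
  -- `𝒢`, and the other has size k and contains it.
  have hunion : (A ∪ B).card ≤ (C ∩ D).card := Finset.card_le_card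
    (Finset.union_subset (Finset.subset_inter hAC.subset hAD.subset)
      (Finset.subset_inter hBC.subset hBD.subset))
  have hCDi : (C ∩ D).card < C.card ∨ (C ∩ D).card < D.card := by
    by_contra hcon
    push Not at hcon
    have e1 := Finset.eq_of_subset_of_card_le Finset.inter_subset_left hcon.1
    have e2 := Finset.eq_of_subset_of_card_le Finset.inter_subset_right hcon.2
    exact hCD (e1.symm.trans e2)
  have hABu : A.card < (A ∪ B).card ∨ B.card < (A ∪ B).card := by
    by_contra hcon
    push Not at hcon
    have e1 := Finset.eq_of_subset_of_card_le Finset.subset_union_left hcon.1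
    have e2 := Finset.eq_of_subset_of_card_le Finset.subset_union_right hcon.2
    exact hAB (e1.trans e2.symm)
  have hone : ∀ A B : Finset (Fin n), A ≠ B → (A ∪ B).card ≤ (C ∩ D).card → A ⊂ C → A ⊂ D →
      B ⊂ C → B ⊂ D → A ∈ 𝒢 → A.card + 1 = k → B.card = k → C.card = k + 1 → D.card = k + 1 →
      (C ∩ D).card ≤ k → {A, B, C, D} ∈ 𝒢.biUnion P := by
    intro A B hAB hu hAC hAD hBC hBD hA hAk hBk hCk hDk hi
    have hABsub : A ⊆ B := by
      have : B = A ∪ B := Finset.eq_of_subset_of_card_le Finset.subset_union_right (by omega)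
      rw [this]; exact Finset.subset_union_left
    refine Finset.mem_biUnion.2 ⟨A, hA, Finset.mem_image.2 ⟨⟨B, {C, D}⟩, ?_, rfl⟩⟩
    refine Finset.mem_sigma.2 ⟨mem_ups.2 ⟨hABsub, by change B.card = _; omega⟩, Finset.mem_powersetCard.2
      ⟨?_, Finset.card_pair hCD⟩⟩
    intro X hX
    rcases Finset.mem_insert.1 hX with rfl | h
    · exact mem_ups.2 ⟨hBC.subset, by change _ = B.card + 1; omega⟩
    · rw [Finset.mem_singleton.1 h]
      exact mem_ups.2 ⟨hBD.subset, by change _ = B.card + 1; omega⟩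
  have hgg : A ∈ 𝒢 → B ∈ 𝒢 → k < (A ∪ B).card := fun h1 h2 => hsep A h1 B h2 hAB
  have hCDle : (C ∩ D).card ≤ C.card ∧ (C ∩ D).card ≤ D.card :=
    ⟨Finset.card_le_card Finset.inter_subset_left, Finset.card_le_card Finset.inter_subset_right⟩
  rcases mA with ⟨gA, kA⟩ | mA
  · rcases mB with ⟨gB, kB⟩ | mB
    · have := hgg gA gB
      omega
    · exact hone A B hAB hunion hAC hAD hBC hBD gA kA (by omega) (by omega) (by omega) (by omega)
  · rcases mB with ⟨gB, kB⟩ | mB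
    · have h1 := hone B A hAB.symm (by rwa [Finset.union_comm]) hBC hBD hAC hAD gB kB (by omega)
        (by omega) (by omega) (by omega)
      rwa [Finset.insert_comm] at h1
    · omega

/-- The lower levels ⌊n/2⌋ and ⌊n/2⌋ + 1 are used with the sets added below, since n - ⌊n/2⌋ = ⌈n/2⌉
turns the number of obvious butterflies per added set into f(n). -/
theorem exists_butterflyCount_eq {E : ℕ} (hE : 100 * E ≤ n) :
    ∃ F : Finset (Finset (Fin n)), F.card = sigmaTwo n + E ∧ butterflyCount F = E * f n := by
  obtain ⟨𝒢, hc, h1, h2⟩ : ∃ 𝒢 : Finset (Finset (Fin n)), 𝒢.card = E ∧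
      (∀ G ∈ 𝒢, G.card + 1 = n / 2) ∧
      ∀ G ∈ 𝒢, ∀ G' ∈ 𝒢, G ≠ G' → n / 2 < (G ∪ G').card := by
    rcases Nat.eq_zero_or_pos E with h | h
    · exact ⟨∅, by simp [h]⟩
    · exact exists_separated_family (by omega) (by omega)
  have hcard : (layers n (n / 2) ∪ 𝒢).card = sigmaTwo n + E := by
    rw [Finset.card_union_of_disjoint, card_layers, hc, sigmaTwo]
    refine Finset.disjoint_left.2 fun A hA hA' => ?_
    have := mem_layers.1 hA
    have := h1 A hA'
    omega
  refine ⟨_, hcard, le_antisymm ?_ (mul_f_le_butterflyCount hE hcard)⟩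
  have := butterflyCount_layers_union_le h1 h2
  rwa [hc, show n - n / 2 = (n + 1) / 2 by omega] at this

end Construction

/-! ### Subexponential excess and the error sequence. -/

section Asymptotic

/-- The asymptotic lower bound with an explicit error term. -/
theorem mul_le_pow_mul_butterflyCount {n E p : ℕ} (hp : 2 ≤ p) (hn : 22 ≤ n)
    (hpn : p ≤ (n + 1) / 2) (hE : n ^ 3 * (E * f n) ≤ 2 ^ ((n + 1) / 2 / p / p))
    {F : Finset (Finset (Fin n))} (hF : F.card = sigmaTwo n + E) :
    (p - 1) ^ 4 * (E * f n) ≤ p ^ 4 * butterflyCount F := by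
  rcases Nat.lt_or_ge (butterflyCount F) (E * f n) with hb | hb
  · set m := (n + 1) / 2 with hm
    -- A threshold near m/p keeps g ≥ ((p-1)/p)³ f(n), and l near h/p makes the percolation add at
    -- most r/p sets.
    set h := m / p with hh
    set l := h / p with hl
    have hhpos : 0 < h := Nat.div_pos hpn (by omega)
    have hlh : l < h := Nat.div_lt_self hhpos (by omega)
    have hhm : h ≤ m := Nat.div_le_self _ _
    have hpl : p * l ≤ h := Nat.mul_div_le h p
    have hph : p * h ≤ m := Nat.mul_div_le m p
    obtain ⟨k, hk1, hk2, hk, hr⟩ := exists_layers_of_butterflyCount_lt hn hF hb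
      (hE.trans (Nat.pow_le_pow_right (by norm_num) (by omega)))
    obtain ⟨z, hz, hb⟩ := exists_butterflyCount_ge (h := h) (l := l) hF hk hk1 hk2
      hhm hlh (by omega)
    have hg := pow_mul_f_le (n := n) (p := p) (q := p - 1) (h := h) (by omega) (by
      obtain ⟨p', rfl⟩ : ∃ p', p = p' + 1 := ⟨p - 1, by omega⟩
      rw [← hm]
      simp only [Nat.add_sub_cancel]
      nlinarith) (by omega)
    set g := ((n + 1) / 2 + 2 - h) * ((n + 1) / 2 + 1 - h).choose 2
    set r := (layers n k \ F).card
    have hz' : p * z ≤ r := by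
      have h1 : h * (2 * (p * z)) ≤ h * (r + z) := by
        calc h * (2 * (p * z)) = p * (2 * h * z) := by ring
          _ ≤ p * (l * (r + z)) := Nat.mul_le_mul_left _ hz
          _ = (p * l) * (r + z) := by ring
          _ ≤ _ := Nat.mul_le_mul_right _ hpl
      have h2 := Nat.le_of_mul_le_mul_left h1 hhpos
      have h3 : z ≤ p * z := Nat.le_mul_of_pos_left z (by omega)
      omega
    obtain ⟨q, rfl⟩ : ∃ q, p = q + 1 := ⟨p - 1, by omega⟩
    simp only [Nat.add_sub_cancel] at hg ⊢
    have h3 : q * E * g ≤ (q + 1) * butterflyCount F := by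
      have h4 : (q + 1) * ((r + E) * g) ≤ (q + 1) * (butterflyCount F + z * g) :=
        Nat.mul_le_mul_left _ hb
      have h5 : (q + 1) * z * g ≤ r * g := Nat.mul_le_mul_right _ hz'
      nlinarith [Nat.zero_le (q * r * g), Nat.zero_le (E * g)]
    calc q ^ 4 * (E * f n) = (q * E) * (q ^ 3 * f n) := by ring
      _ ≤ (q * E) * ((q + 1) ^ 3 * g) := Nat.mul_le_mul_left _ hg
      _ = (q + 1) ^ 3 * (q * E * g) := by ring
      _ ≤ (q + 1) ^ 3 * ((q + 1) * butterflyCount F) := Nat.mul_le_mul_left _ h3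
      _ = _ := by ring
  · exact Nat.mul_le_mul (Nat.pow_le_pow_left (Nat.sub_le _ _) 4) hb

/-- For E(n) > 0 the logarithm of the left side is at most log E(n) + 6 log n = o(n), while the
exponent on the right is at least n/(2p²) - 1. -/
theorem eventually_pow_mul_le {E : ℕ → ℕ}
    (hE : (fun n : ℕ => Real.log (E n : ℝ)) =o[atTop] (fun n : ℕ => (n : ℝ))) (p : ℕ)
    (hp : 0 < p) : ∀ᶠ n : ℕ in atTop, n ^ 3 * (E n * f n) ≤ 2 ^ ((n + 1) / 2 / p / p) := by
  have hlog : (fun n : ℕ => Real.log (n : ℝ)) =o[atTop] (fun n : ℕ => (n : ℝ)) :=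
    Real.isLittleO_log_id_atTop.comp_tendsto tendsto_natCast_atTop_atTop
  have hl2 : 0 < Real.log 2 := Real.log_pos (by norm_num)
  have hpR : (0 : ℝ) < p := by exact_mod_cast hp
  set c : ℝ := Real.log 2 / (2 * p ^ 2) with hc
  have hcpos : 0 < c := by positivity
  have hsum := (hE.add (hlog.const_mul_left 6)).bound (show 0 < c / 2 by positivity)
  have hlarge : ∀ᶠ n : ℕ in atTop, Real.log 2 ≤ c / 2 * n :=
    (tendsto_natCast_atTop_atTop.const_mul_atTop (show 0 < c / 2 by positivity)).eventually_ge_atTop _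
  filter_upwards [hsum, hlarge, eventually_ge_atTop 4] with n h1 h2 h4
  rcases Nat.eq_zero_or_pos (E n) with h0 | h0
  · rw [h0]; simp
  have hER : (0 : ℝ) < E n := by exact_mod_cast h0
  have hnR : (0 : ℝ) < n := by exact_mod_cast (show 0 < n by omega)
  have h5 : n ^ 3 * (E n * f n) ≤ n ^ 6 * E n := by
    have := eight_mul_f_le h4
    calc n ^ 3 * (E n * f n) ≤ n ^ 3 * (E n * n ^ 3) :=
          Nat.mul_le_mul_left _ (Nat.mul_le_mul_left _ (by omega))
      _ = _ := by ring
  refine h5.trans ?_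
  rw [Real.norm_of_nonneg hnR.le] at h1
  have h6 := (le_abs_self _).trans h1
  have h7 : Real.log ((n : ℝ) ^ 6 * E n) ≤ ((n + 1) / 2 / p / p : ℕ) * Real.log 2 := by
    rw [Real.log_mul (by positivity) hER.ne', Real.log_pow]
    have h8 : (n : ℝ) / (2 * p ^ 2) - 1 ≤ ((n + 1) / 2 / p / p : ℕ) := by
      rw [Nat.div_div_eq_div_mul, Nat.div_div_eq_div_mul, ← mul_assoc]
      have h9 := Nat.lt_div_mul_add (a := n + 1) (b := 2 * p * p) (by positivity)
      set s := (n + 1) / (2 * p * p)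
      have h10 : (n : ℝ) ≤ s * (2 * p * p) + 2 * p * p := by
        exact_mod_cast (by omega : n ≤ s * (2 * p * p) + 2 * p * p)
      rw [sub_le_iff_le_add, div_le_iff₀ (by positivity)]
      nlinarith
    have h11 := mul_le_mul_of_nonneg_right h8 hl2.le
    have h12 : ((n : ℝ) / (2 * p ^ 2) - 1) * Real.log 2 = c * n - Real.log 2 := by
      rw [hc]; ring
    push_cast
    linarith
  rw [← Real.log_pow] at h7
  have h8 := (Real.log_le_log_iff (by positivity) (by positivity)).1 h7
  exact_mod_cast h8

theorem eventually_le_butterflyCount {E : ℕ → ℕ}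
    (hE : (fun n : ℕ => Real.log (E n : ℝ)) =o[atTop] (fun n : ℕ => (n : ℝ))) {ε : ℝ}
    (hε : 0 < ε) : ∀ᶠ n : ℕ in atTop, ∀ F : Finset (Finset (Fin n)),
      F.card = sigmaTwo n + E n →
        (1 - ε) * ((E n : ℝ) * (f n : ℝ)) ≤ (butterflyCount F : ℝ) := by
  -- Chosen so that (1 - 1/p)^4 ≥ 1 - 4/p ≥ 1 - ε.
  obtain ⟨p, hp⟩ := exists_nat_ge (4 / ε + 2)
  have hp2 : (2 : ℝ) ≤ p := by have : 0 < 4 / ε := by positivity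
                               linarith
  have hp2' : 2 ≤ p := by exact_mod_cast hp2
  have hpε : 4 ≤ ε * p := by
    have h1 : 4 / ε ≤ p := by linarith
    rw [div_le_iff₀ hε] at h1
    linarith
  filter_upwards [eventually_pow_mul_le hE p (by omega), eventually_ge_atTop 22,
    eventually_ge_atTop (2 * p)] with n h1 h2 h3 F hF
  have h4 := mul_le_pow_mul_butterflyCount hp2' h2 (by omega) h1 hF
  have h5 : ((p : ℝ) - 1) ^ 4 * ((E n : ℝ) * f n) ≤ (p : ℝ) ^ 4 * butterflyCount F := by
    have h6 : (((p - 1 : ℕ) : ℝ)) ^ 4 * ((E n : ℝ) * f n) ≤ (p : ℝ) ^ 4 * butterflyCount F := by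
      exact_mod_cast h4
    rwa [Nat.cast_sub (by omega), Nat.cast_one] at h6
  have h6 : (1 - ε) * (p : ℝ) ^ 4 ≤ ((p : ℝ) - 1) ^ 4 := by
    have h7 : (p : ℝ) ^ 4 - 4 * p ^ 3 ≤ ((p : ℝ) - 1) ^ 4 := by nlinarith
    have h8 : 4 * (p : ℝ) ^ 3 ≤ ε * p * p ^ 3 := mul_le_mul_of_nonneg_right hpε (by positivity)
    nlinarith
  have h7 : (0 : ℝ) ≤ (E n : ℝ) * f n := by positivity
  have h8 := mul_le_mul_of_nonneg_right h6 h7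
  have h9 : (0 : ℝ) < (p : ℝ) ^ 4 := by positivity
  refine le_of_mul_le_mul_left ?_ h9
  linarith

/-- The largest relative deficiency of the number of butterflies from `E f(n)`. -/
noncomputable def deficiency (n E : ℕ) : ℝ :=
  (Finset.univ : Finset (Finset (Finset (Fin n)))).sup' Finset.univ_nonempty fun F =>
    if F.card = sigmaTwo n + E then
      max 0 ((E : ℝ) * f n - butterflyCount F) / ((E : ℝ) * f n) else 0

theorem deficiency_nonneg (n E : ℕ) : 0 ≤ deficiency n E := by
  refine le_trans ?_ (Finset.le_sup' _ (Finset.mem_univ ∅))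
  split_ifs <;> positivity

theorem one_sub_deficiency_mul_le {n E : ℕ} {F : Finset (Finset (Fin n))}
    (hF : F.card = sigmaTwo n + E) :
    (1 - deficiency n E) * ((E : ℝ) * f n) ≤ butterflyCount F := by
  rcases (show (0 : ℝ) ≤ (E : ℝ) * f n by positivity).eq_or_lt with h0 | h0
  · rw [← h0, mul_zero]; positivity
  · have h1 : max 0 ((E : ℝ) * f n - butterflyCount F) / ((E : ℝ) * f n) ≤ deficiency n E := by
      have := Finset.le_sup' (fun F : Finset (Finset (Fin n)) =>
        if F.card = sigmaTwo n + E then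
          max 0 ((E : ℝ) * f n - butterflyCount F) / ((E : ℝ) * f n) else 0) (Finset.mem_univ F)
      simp only [if_pos hF] at this
      exact this
    rw [div_le_iff₀ h0] at h1
    have := (le_max_right 0 ((E : ℝ) * f n - butterflyCount F)).trans h1
    linarith

theorem deficiency_le {n E : ℕ} {ε : ℝ} (hε : 0 ≤ ε)
    (h : ∀ F : Finset (Finset (Fin n)), F.card = sigmaTwo n + E →
      (1 - ε) * ((E : ℝ) * (f n : ℝ)) ≤ (butterflyCount F : ℝ)) : deficiency n E ≤ ε := by
  refine Finset.sup'_le _ _ fun F _ => ?_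
  split_ifs with hF
  · have h1 := h F hF
    refine div_le_of_le_mul₀ (by positivity) hε (max_le (by positivity) ?_)
    linarith
  · exact hε

/-- As a supremum over all families, the deficiency depends only on n and E(n) and serves every n at
once, small ones included; only its decay uses the eventual bound. -/
theorem deficiency_isLittleO {E : ℕ → ℕ}
    (hE : (fun n : ℕ => Real.log (E n : ℝ)) =o[atTop] (fun n : ℕ => (n : ℝ))) :
    (fun n => deficiency n (E n)) =o[atTop] (fun _ : ℕ => (1 : ℝ)) := by
  rw [isLittleO_iff]
  intro ε hε
  filter_upwards [eventually_le_butterflyCount hE hε] with n hn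
  rw [Real.norm_of_nonneg (deficiency_nonneg _ _), norm_one, mul_one]
  exact deficiency_le hε.le hn

end Asymptotic

end Butterflies

theorem theorem1p3 :
    -- (a)
    (∀ E : ℕ → ℕ, (fun n : ℕ => Real.log (E n : ℝ)) =o[atTop] (fun n : ℕ => (n : ℝ)) →
      ∃ δ : ℕ → ℝ, δ =o[atTop] (fun _ : ℕ => (1 : ℝ)) ∧
        ∀ (n : ℕ) (F : Finset (Finset (Fin n))),
          F.card = Butterflies.sigmaTwo n + E n →
            (1 - δ n) * ((E n : ℝ) * (Butterflies.f n : ℝ)) ≤ (Butterflies.butterflyCount F : ℝ)) ∧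
    -- (b)
    (∀ n E : ℕ, (E : ℝ) ≤ (n : ℝ) / 100 →
      (∀ F : Finset (Finset (Fin n)), F.card = Butterflies.sigmaTwo n + E →
        E * Butterflies.f n ≤ Butterflies.butterflyCount F) ∧
      (∃ F : Finset (Finset (Fin n)), F.card = Butterflies.sigmaTwo n + E ∧
        Butterflies.butterflyCount F = E * Butterflies.f n)) := by
  refine ⟨fun E hE => ⟨fun n => Butterflies.deficiency n (E n),
    Butterflies.deficiency_isLittleO hE, fun n F hF => Butterflies.one_sub_deficiency_mul_le hF⟩,
    fun n E hE => ?_⟩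
  have hE' : 100 * E ≤ n := by
    have h : (100 : ℝ) * E ≤ n := by linarith
    exact_mod_cast h
  exact ⟨fun F hF => Butterflies.mul_f_le_butterflyCount hE' hF,
    Butterflies.exists_butterflyCount_eq hE'⟩
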